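/- Let $\mathbf{k}$ be a field of characteristic $0$ and $\lambda\in\mathbf{k}$. Algebras are associative and unital. A differential algebra of weight $\lambda$ is a $\mathbf{k}$-algebra $R$ with a linear operator $d$ such that $d(xy)=d(x)y+x\,d(y)+\lambda\, d(x)d(y)$ and $d(1)=0$; homomorphisms are algebra homomorphisms commuting with the operators. The free differential algebra of weight $\lambda$ on an algebra $A$ is a differential algebra $(\mathcal{D}_\lambda(A),d)$ of weight $\lambda$ with an algebra homomorphism $i_A:A\to\mathcal{D}_\lambda(A)$ such that every algebra homomorphism from $A$ to a differential algebra $R$ of weight $\lambda$ factors through $i_A$ by a unique homomorphism of differential algebras $\mathcal{D}_\lambda(A)\to R$. Let $X$ be a set, $M(X)$ the free monoid on $X$, and $<$ a monomial order on $M(X)$, that is, a well-order with least element $1$ such that $u<v$ implies $wuz<wvz$ for all words $w,z$. Write $\overline{f}$ for the leading word of $f\in\mathbf{k}\langle X\rangle\setminus\{0\}$. A set $S$ of monic polynomials in $\mathbf{k}\langle X\rangle$ is a Gröbner–Shirshov basis of a two-sided ideal $I$ if it generates $I$ and every composition of elements $f,g\in S$ at a word $w$, namely $fu-vg$ with $w=\overline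 f u=v\overline g$, $|w|<|\overline f|+|\overline g|$ (intersection), and $f-agb$ with $w=\overline f=a\overline g b$ (inclusion), $u,v,a,b\in M(X)$, is a linear combination of polynomials $a's\,b'$ with $s\in S$, $a',b'\in M(X)$, $a'\overline s b'<w$. Let $A$ be an algebra with a presentation $A=\mathbf{k}\langle X\rangle/I_A$, and let $S_A$ be a Gröbner–Shirshov basis of $I_A$. Let $\Delta(X)=\{x^{(n)}\mid x\in X,\ n\ge 0\}$. For a word $\mathfrak{x}=x_1\cdots x_k\in M(X)$ and $n\ge0$ put $$\mathfrak{x}^{[n]}=\begin{cases}x_1^{(n)}x_2^{(n)}\cdots x_k^{(n)},&\lambda\neq0,\\ x_1^{(n)}x_2^{(0)}\cdots x_k^{(0)},&\lambda=0,\end{cases}\qquad 1^{[n]}=1,$$ and let $$\mathcal{B}=\{\mathfrak{x}\in M(\Delta(X))\mid \overline{s}^{[n]}\text{ is not a subword (factor) of }\mathfrak{x}\text{ for any }s\in S_A,\ n\ge0\}.$$ Then: 1. The words in $\mathcal{B}$, read in $\mathcal{D}_\lambda(A)$ by sending $x^{(n)}$ to $d^n(i_A(\bar x))$, where $\bar x$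 is the image of $x$ in $A$, form a $\mathbf{k}$-basis of the free differential algebra $\mathcal{D}_\lambda(A)$ of weight $\lambda$ on $A$ (distinct words giving distinct basis elements). 2. If $<$ is the deg-lex order induced by a well-order on $X$, then $\mathcal{B}$ is the set of differential $\hat S_A$-irreducible words, that is, of the words in $M(\Delta(X))$ that are not of the form $\mathfrak{a}\,\overline{d_X^n(s^{(0)})}\,\mathfrak{b}$ with $s\in S_A$, $n\ge 0$, $d_X^n(s^{(0)})\ne0$ and $\mathfrak{a},\mathfrak{b}\in M(\Delta(X))$. Here $s^{(0)}\in\mathbf{k}\langle\Delta(X)\rangle$ arises from $s$ by $x\mapsto x^{(0)}$, $d_X$ is the differential operator of weight $\lambda$ on $\mathbf{k}\langle\Delta(X)\rangle$ with $d_X(x^{(n)})=x^{(n+1)}$, and leading words are taken for the deg-lex order on $M(\Delta(X))$ induced by: $x^{(m)}\prec y^{(n)}$ if $m<n$, or $m=n$ and $x<y$. -/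

import Mathlib

universe u

noncomputable section

/-! ### Noncommutative polynomials, monomial orders, leading words -/

/-- The noncommutative polynomial algebra `k⟨X⟩`, with linear basis the words in `X`. -/
abbrev NCPoly (k X : Type u) [Field k] : Type u := MonoidAlgebra k (FreeMonoid X)

/-- A word regarded as a noncommutative polynomial. -/
abbrev ncWord (k : Type u) {X : Type u} [Field k] (w : FreeMonoid X) : NCPoly k X :=
  MonoidAlgebra.of k (FreeMonoid X) w

/-- A monomial order on the words in `X`: a well-order for which the empty word is the least word
and which is compatible with left and right multiplication. -/
structure WordOrder (X : Type u) where
  lt : FreeMonoid X → FreeMonoid X → Prop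
  isWellOrder : IsWellOrder (FreeMonoid X) lt
  one_lt : ∀ w : FreeMonoid X, w ≠ 1 → lt 1 w
  mul_lt_mul : ∀ a u v b : FreeMonoid X, lt u v → lt (a * u * b) (a * v * b)

/-- The deg-lex relation on words induced by a relation on letters: first compare lengths, then
compare lexicographically from the left. -/
def degLex {X : Type u} (r : X → X → Prop) (v w : FreeMonoid X) : Prop :=
  List.Shortlex r (FreeMonoid.toList v) (FreeMonoid.toList w)

/-- `w` is the leading word of `f` with respect to `lt` (so `f` is nonzero). -/
def IsLeadingWord {k X : Type u} [Field k] (lt : FreeMonoid X → FreeMonoid X → Prop)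
    (f : NCPoly k X) (w : FreeMonoid X) : Prop :=
  f.coeff w ≠ 0 ∧ ∀ v : FreeMonoid X, f.coeff v ≠ 0 → v ≠ w → lt v w

/-! ### Gröbner–Shirshov bases of ideals of `k⟨X⟩` -/

/-- `f` is trivial modulo `(S, w)`: it is a linear combination of polynomials `a s b` with `s ∈ S`,
`a, b` words, whose leading words `a s̄ b` are smaller than `w`. -/
def TrivialModulo {k X : Type u} [Field k] (lt : FreeMonoid X → FreeMonoid X → Prop)
    (S : Set (NCPoly k X)) (w : FreeMonoid X) (f : NCPoly k X) : Prop :=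
  f ∈ Submodule.span k {g : NCPoly k X | ∃ s ∈ S, ∃ a b t : FreeMonoid X,
    IsLeadingWord lt s t ∧ lt (a * t * b) w ∧ g = ncWord k a * s * ncWord k b}

/-- `S` is a Gröbner–Shirshov basis in `k⟨X⟩`: a set of monic polynomials all of whose intersection
compositions and inclusion compositions are trivial. -/
structure IsGSBasis {k X : Type u} [Field k] (ord : WordOrder X) (S : Set (NCPoly k X)) :
    Prop where
  monic : ∀ f ∈ S, ∃ t : FreeMonoid X, IsLeadingWord ord.lt f t ∧ f.coeff t = 1
  intersection : ∀ f ∈ S, ∀ g ∈ S, ∀ p q u v w : FreeMonoid X,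
    IsLeadingWord ord.lt f p → IsLeadingWord ord.lt g q →
    w = p * u → w = v * q → w.length < p.length + q.length →
    TrivialModulo ord.lt S w (f * ncWord k u - ncWord k v * g)
  inclusion : ∀ f ∈ S, ∀ g ∈ S, ∀ a b q w : FreeMonoid X,
    IsLeadingWord ord.lt f w → IsLeadingWord ord.lt g q → w = a * q * b →
    TrivialModulo ord.lt S w (f - ncWord k a * g * ncWord k b)

/-- `S` is a Gröbner–Shirshov basis of the two-sided ideal `I` of `k⟨X⟩`. -/
def IsGSBasisOf {k X : Type u} [Field k] (ord : WordOrder X) (S : Set (NCPoly k X))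
    (I : TwoSidedIdeal (NCPoly k X)) : Prop :=
  IsGSBasis ord S ∧ TwoSidedIdeal.span S = I

/-! ### Differential algebras of weight `lam` -/

/-- `d` is a differential operator of weight `lam` on the unital algebra `R`. -/
structure IsDiffOp {k R : Type u} [Field k] [Ring R] [Algebra k R] (lam : k) (d : R →ₗ[k] R) :
    Prop where
  leibniz : ∀ x y : R, d (x * y) = d x * y + x * d y + lam • (d x * d y)
  map_one : d 1 = 0

/-- `(D, d)` together with `i : A → D` is a free differential algebra of weight `lam` on the
algebra `A`. -/
structure IsFreeDiffAlgebra {k A D : Type u} [Field k] [Ring A] [Algebra k A] [Ring D]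
    [Algebra k D] (lam : k) (d : D →ₗ[k] D) (i : A →ₐ[k] D) : Prop where
  isDiffOp : IsDiffOp lam d
  universal : ∀ (R : Type u) [Ring R] [Algebra k R] (dR : R →ₗ[k] R), IsDiffOp lam dR →
    ∀ φ : A →ₐ[k] R, ∃! ψ : D →ₐ[k] R, (∀ x : D, ψ (d x) = dR (ψ x)) ∧ ψ.comp i = φ

/-! ### Differential words

The set of differential letters `Δ(X)` is `X × ℕ`, the pair `(x, n)` being `x^{(n)}`. -/

/-- The word `x₁⋯x_k` with exponent `[n]`: it is `x₁^{(n)}x₂^{(n)}⋯x_k^{(n)}` if `lam ≠ 0`, and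
`x₁^{(n)}x₂^{(0)}⋯x_k^{(0)}` if `lam = 0`; the empty word stays empty. -/
def diffPow {k X : Type u} [Field k] (lam : k) (n : ℕ) (w : FreeMonoid X) : FreeMonoid (X × ℕ) :=
  open Classical in
  if lam ≠ 0 then FreeMonoid.map (fun x => (x, n)) w
  else match FreeMonoid.toList w with
    | [] => 1
    | x :: l => FreeMonoid.of (x, n) * FreeMonoid.map (fun y => (y, 0)) (FreeMonoid.ofList l)

/-- The words in `Δ(X)` with no subword `s̄^{[n]}`, for `s̄` a leading word of an element of `S`
and `n ≥ 0`. -/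
def avoidingWords {k X : Type u} [Field k] (lam : k) (lt : FreeMonoid X → FreeMonoid X → Prop)
    (S : Set (NCPoly k X)) : Set (FreeMonoid (X × ℕ)) :=
  {z | ∀ s ∈ S, ∀ t : FreeMonoid X, IsLeadingWord lt s t → ∀ (n : ℕ) (a b : FreeMonoid (X × ℕ)),
    z ≠ a * diffPow lam n t * b}

/-- The value of a word in `Δ(X)` in an algebra `D` with an operator `d`, for an assignment
`X → D` of the letters: `x^{(n)}` is sent to `d^n(x)`. -/
def diffWordEval {k X D : Type u} [Field k] [Ring D] [Algebra k D] (d : D →ₗ[k] D) (e : X → D) :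
    FreeMonoid (X × ℕ) →* D :=
  FreeMonoid.lift (fun p : X × ℕ => d^[p.2] (e p.1))

/-! ### The free differential algebra `k⟨Δ(X)⟩` on `X` and differentially irreducible words -/

/-- The operator `d_X` on words, by recursion on the word. -/
def dWord {k X : Type u} [Field k] (lam : k) : List (X × ℕ) → NCPoly k (X × ℕ)
  | [] => 0
  | p :: l =>
      ncWord k (FreeMonoid.of (p.1, p.2 + 1)) * ncWord k (FreeMonoid.ofList l)
      + ncWord k (FreeMonoid.of p) * dWord lam l
      + lam • (ncWord k (FreeMonoid.of (p.1, p.2 + 1)) * dWord lam l)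

/-- The operator `d_X` on `k⟨Δ(X)⟩`, the linear extension of `dWord`. -/
def dX {k X : Type u} [Field k] (lam : k) : NCPoly k (X × ℕ) →ₗ[k] NCPoly k (X × ℕ) :=
  (Finsupp.linearCombination k
    (fun w : FreeMonoid (X × ℕ) => dWord lam (FreeMonoid.toList w))).comp
    (MonoidAlgebra.coeffLinearEquiv k).toLinearMap

/-- The embedding `k⟨X⟩ → k⟨Δ(X)⟩`, `x ↦ x^{(0)}`. -/
def hatEmbedding {k X : Type u} [Field k] : NCPoly k X →ₐ[k] NCPoly k (X × ℕ) :=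
  MonoidAlgebra.mapDomainAlgHom k k (FreeMonoid.map (fun x : X => (x, 0)))

/-- The order on `Δ(X)` extending an order on `X`: `x^{(m)} ≺ y^{(n)}` if `m < n`, or `m = n` and
`x < y`. -/
def deltaLT {X : Type u} (r : X → X → Prop) (p q : X × ℕ) : Prop :=
  p.2 < q.2 ∨ (p.2 = q.2 ∧ r p.1 q.1)

/-- The set `DIrr(T)` of differential `T`-irreducible words with respect to an order on the words
in `Δ(X)`: the words that are not of the form `a t b` with `t` the leading word of some `d_X^n(f)`,
`f ∈ T`. -/
def DIrr {k X : Type u} [Field k] (lam : k)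
    (lt : FreeMonoid (X × ℕ) → FreeMonoid (X × ℕ) → Prop) (T : Set (NCPoly k (X × ℕ))) :
    Set (FreeMonoid (X × ℕ)) :=
  {z | ∀ f ∈ T, ∀ (n : ℕ) (t : FreeMonoid (X × ℕ)), IsLeadingWord lt ((dX lam)^[n] f) t →
    ∀ a b : FreeMonoid (X × ℕ), z ≠ a * t * b}

end

noncomputable section

namespace NCDiff

variable {k X Z : Type u} [Field k]

/-! Write `t` for the leading word of `s ∈ S`. Spanning and linear independence are proved by
different means.

Spanning. All `d^n(s)` vanish in `D`. In `d^n(w)`, for a nonempty word `w`, the word `w^[n]` has a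
nonzero coefficient: for `lam ≠ 0` every letter is differentiated `n` times and the coefficient is a
power of `lam`; for `lam = 0` only the first letter is differentiated and the coefficient is `1`.
For a suitable well-founded multiplicative order, `t^[n]` is then the leading word of `d^n(s)`
(`isLeadingWord_dX_iterate`), so a word with a factor `t^[n]` can be rewritten in smaller words
(`span_avoidingWords`). Since `<` is an arbitrary monomial order, suitable orders on differential
words are built from it: `levelLT` for `lam ≠ 0` and `markLT` for `lam = 0`.

Independence. Instead of studying compositions of the `d^n(s)`, one maps `D` to a concrete
differential algebra in which the avoiding words are visibly independent. For `lam ≠ 0` this is the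
free product of copies `A_n` of `A`, `n ≥ 0`, with `d = lam⁻¹(σ - 1)` for the shift `σ`; there
`d^n(x)` has leading term `lam⁻ⁿ x^{(n)}`. For `lam = 0` it is the free product of `A` with `k[y]`,
with `d = [y, -]`; there `d^n(x)` has leading term `yⁿx`, and an occurrence of `t` in
`y^{n₁}x₁y^{n₂}x₂⋯` comes from a factor `t^[n]` of the differential word, which explains the shape
of `t^[n]` in weight zero. Both algebras are presented by disjoint copies of `S`. Compositions stay
inside one copy, so the presentation is confluent (`confluent_copies`), normal forms exist
(`exists_normalForm`), and elements with distinct irreducible leading words are independent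
(`linearIndependent_lift`).

The second claim holds because deg-lex also makes `t^[n]` the leading word of `d^n(s)`
(`degLex_compatible`). If some `t` is the empty word, then `A = 0`, `D = 0` and no word is avoiding;
this case is treated apart. -/

/-- The span of a set of words. -/
def wordSpan (k : Type u) {X : Type u} [Field k] (s : Set (FreeMonoid X)) :
    Submodule k (NCPoly k X) :=
  Submodule.span k (ncWord k '' s)

theorem ncWord_mul (a b : FreeMonoid X) : ncWord k (a * b) = ncWord k a * ncWord k b :=
  map_mul _ _ _

theorem ncWord_one : ncWord k (1 : FreeMonoid X) = 1 := map_one _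

theorem coeff_ncWord_self (a : FreeMonoid X) : (ncWord k a).coeff a = 1 := by
  simp

theorem coeff_ncWord_ne {a b : FreeMonoid X} (h : a ≠ b) : (ncWord k a).coeff b = 0 := by
  simp [h]

theorem wordSpan_eq_supported (s : Set (FreeMonoid X)) :
    wordSpan k s = MonoidAlgebra.supported k k s := by
  rw [MonoidAlgebra.supported_eq_span_single]
  rfl

theorem mem_wordSpan_iff {s : Set (FreeMonoid X)} {f : NCPoly k X} :
    f ∈ wordSpan k s ↔ ∀ v, f.coeff v ≠ 0 → v ∈ s := by
  rw [wordSpan_eq_supported, MonoidAlgebra.mem_supported']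
  exact forall_congr' fun v => by rw [not_imp_comm]

theorem ncWord_mem_wordSpan {s : Set (FreeMonoid X)} {v : FreeMonoid X} (h : v ∈ s) :
    ncWord k v ∈ wordSpan k s :=
  Submodule.subset_span ⟨v, h, rfl⟩

theorem wordSpan_mono {s t : Set (FreeMonoid X)} (h : s ⊆ t) : wordSpan k s ≤ wordSpan k t :=
  Submodule.span_mono (Set.image_mono h)

theorem mem_wordSpan_univ (f : NCPoly k X) : f ∈ wordSpan k (Set.univ : Set (FreeMonoid X)) :=
  mem_wordSpan_iff.2 fun _ _ => trivial

theorem wordSpan_le {s : Set (FreeMonoid X)} {P : Submodule k (NCPoly k X)}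
    (h : ∀ v ∈ s, ncWord k v ∈ P) : wordSpan k s ≤ P := by
  rw [wordSpan, Submodule.span_le]
  rintro _ ⟨v, hv, rfl⟩
  exact h v hv

/-- To check that a linear map sends `wordSpan k s` into a submodule, it suffices to check words. -/
theorem map_mem_of_wordSpan {M : Type*} [AddCommGroup M] [Module k M] {s : Set (FreeMonoid X)}
    (F : NCPoly k X →ₗ[k] M) {P : Submodule k M} (h : ∀ v ∈ s, F (ncWord k v) ∈ P)
    {f : NCPoly k X} (hf : f ∈ wordSpan k s) : F f ∈ P :=
  (wordSpan_le (P := P.comap F) h) hf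

theorem linearMap_ext_words {M : Type*} [AddCommGroup M] [Module k M] {F G : NCPoly k X →ₗ[k] M}
    (h : ∀ w, F (ncWord k w) = G (ncWord k w)) : F = G := by
  refine LinearMap.ext fun f => sub_eq_zero.1 ?_
  exact map_mem_of_wordSpan (P := ⊥) (F - G) (fun w _ => sub_eq_zero.2 (h w)) (mem_wordSpan_univ f)

theorem mul_mem_wordSpan {s t r : Set (FreeMonoid X)} (h : ∀ u ∈ s, ∀ v ∈ t, u * v ∈ r)
    {f g : NCPoly k X} (hf : f ∈ wordSpan k s) (hg : g ∈ wordSpan k t) :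
    f * g ∈ wordSpan k r := by
  refine map_mem_of_wordSpan (LinearMap.mulRight k g) (fun u hu => ?_) hf
  refine map_mem_of_wordSpan (LinearMap.mulLeft k (ncWord k u)) (fun v hv => ?_) hg
  simp only [LinearMap.mulLeft_apply, ← ncWord_mul]
  exact ncWord_mem_wordSpan (h u hu v hv)

/-! ### Multiplicative orders on words and leading terms -/

/-- A well-founded transitive relation on words compatible with multiplication. -/
structure RewriteOrder (lt : FreeMonoid X → FreeMonoid X → Prop) : Prop where
  wf : WellFounded lt
  trans : ∀ {u v w : FreeMonoid X}, lt u v → lt v w → lt u w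
  mul : ∀ (a : FreeMonoid X) {u v : FreeMonoid X} (b : FreeMonoid X), lt u v →
    lt (a * u * b) (a * v * b)

namespace RewriteOrder

variable {lt : FreeMonoid X → FreeMonoid X → Prop}

theorem irrefl (h : RewriteOrder lt) (w : FreeMonoid X) : ¬ lt w w :=
  fun hw => h.wf.asymmetric _ _ hw hw

theorem mul_left (h : RewriteOrder lt) (a : FreeMonoid X) {u v : FreeMonoid X} (huv : lt u v) :
    lt (a * u) (a * v) := by
  simpa using h.mul a 1 huv

theorem mul_right (h : RewriteOrder lt) {u v : FreeMonoid X} (b : FreeMonoid X) (huv : lt u v) :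
    lt (u * b) (v * b) := by
  simpa using h.mul 1 b huv

theorem mul_mul (h : RewriteOrder lt) {u u' v v' : FreeMonoid X} (hu : lt u u') (hv : lt v v') :
    lt (u * v) (u' * v') :=
  h.trans (h.mul_right v hu) (h.mul_left u' hv)

end RewriteOrder

/-- `f` is `c` times the word `p` plus smaller words. -/
def LeadsTo (lt : FreeMonoid X → FreeMonoid X → Prop) (f : NCPoly k X) (p : FreeMonoid X)
    (c : k) : Prop :=
  f - c • ncWord k p ∈ wordSpan k {v | lt v p}

theorem leadsTo_of_isLeadingWord {lt : FreeMonoid X → FreeMonoid X → Prop} {f : NCPoly k X}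
    {p : FreeMonoid X} (h : IsLeadingWord lt f p) : LeadsTo lt f p (f.coeff p) := by
  refine mem_wordSpan_iff.2 fun v hv => ?_
  rcases eq_or_ne v p with rfl | hne
  · simp at hv
  · refine h.2 v (fun h0 => hv ?_) hne
    simp [h0, hne.symm]

theorem LeadsTo.mul {lt : FreeMonoid X → FreeMonoid X → Prop} (hlt : RewriteOrder lt)
    {f g : NCPoly k X} {p q : FreeMonoid X} {c e : k} (hf : LeadsTo lt f p c)
    (hg : LeadsTo lt g q e) : LeadsTo lt (f * g) (p * q) (c * e) := by
  have h : f * g - (c * e) • ncWord k (p * q) =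
      (f - c • ncWord k p) * (g - e • ncWord k q) + (f - c • ncWord k p) * (e • ncWord k q)
        + (c • ncWord k p) * (g - e • ncWord k q) := by
    simp only [ncWord_mul, sub_mul, mul_sub, smul_mul_assoc, mul_smul_comm, smul_smul, mul_comm e c]
    abel
  rw [LeadsTo, h]
  have hp : ∀ (e : k) (q : FreeMonoid X), e • ncWord k q ∈ wordSpan k {q} := fun e q =>
    Submodule.smul_mem _ _ (ncWord_mem_wordSpan rfl)
  refine add_mem (add_mem (mul_mem_wordSpan ?_ hf hg) (mul_mem_wordSpan ?_ hf (hp e q)))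
    (mul_mem_wordSpan ?_ (hp c p) hg)
  · exact fun u hu v hv => hlt.mul_mul hu hv
  · rintro u hu v rfl
    exact hlt.mul_right _ hu
  · rintro u rfl v hv
    exact hlt.mul_left _ hv

theorem leadsTo_one (lt : FreeMonoid X → FreeMonoid X → Prop) :
    LeadsTo lt (1 : NCPoly k X) 1 1 := by
  rw [LeadsTo, ncWord_one, one_smul, sub_self]
  exact zero_mem _

/-! ### Composition-diamond lemma -/

theorem FreeMonoid.mul_eq_mul_cases {p q p' q' : FreeMonoid X} (h : p * q = p' * q') :
    (∃ m, p' = p * m ∧ q = m * q') ∨ (∃ m, p = p' * m ∧ q' = m * q) :=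
  List.append_eq_append_iff.1 h

section Diamond

variable {lt : FreeMonoid X → FreeMonoid X → Prop} {S : Set (NCPoly k X)}

/-- The polynomials that are trivial modulo `(S, w)`, as a subspace. -/
def trivialSubmodule (lt : FreeMonoid X → FreeMonoid X → Prop) (S : Set (NCPoly k X))
    (w : FreeMonoid X) : Submodule k (NCPoly k X) :=
  Submodule.span k {g : NCPoly k X | ∃ s ∈ S, ∃ a b t : FreeMonoid X,
    IsLeadingWord lt s t ∧ lt (a * t * b) w ∧ g = ncWord k a * s * ncWord k b}

theorem generator_mem_trivialSubmodule {s : NCPoly k X} (hs : s ∈ S) {t w : FreeMonoid X}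
    (ht : IsLeadingWord lt s t) (a b : FreeMonoid X) (h : lt (a * t * b) w) :
    ncWord k a * s * ncWord k b ∈ trivialSubmodule lt S w :=
  Submodule.subset_span ⟨s, hs, a, b, t, ht, h, rfl⟩

theorem mul_mem_trivialSubmodule (hlt : RewriteOrder lt) {w : FreeMonoid X} {f : NCPoly k X}
    (hf : f ∈ trivialSubmodule lt S w) (a b : FreeMonoid X) :
    ncWord k a * f * ncWord k b ∈ trivialSubmodule lt S (a * w * b) := by
  have : trivialSubmodule lt S w ≤ (trivialSubmodule lt S (a * w * b)).comap
      ((LinearMap.mulRight k (ncWord k b)).comp (LinearMap.mulLeft k (ncWord k a))) := by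
    rw [trivialSubmodule, Submodule.span_le]
    rintro _ ⟨s, hs, a', b', t, ht, h, rfl⟩
    have := generator_mem_trivialSubmodule hs ht (a * a') (b' * b) (w := a * w * b) (by
      simpa [mul_assoc] using hlt.mul a b h)
    rw [SetLike.mem_coe, Submodule.mem_comap, LinearMap.comp_apply, LinearMap.mulRight_apply,
      LinearMap.mulLeft_apply]
    simpa only [ncWord_mul, mul_assoc] using this
  exact this hf

/-- Any two ways of reducing a word at elements of `S` agree modulo smaller multiples of `S`. -/
def Confluent (lt : FreeMonoid X → FreeMonoid X → Prop) (S : Set (NCPoly k X)) : Prop :=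
  ∀ s ∈ S, ∀ s' ∈ S, ∀ a t b a' t' b' : FreeMonoid X, IsLeadingWord lt s t →
    IsLeadingWord lt s' t' → a * t * b = a' * t' * b' →
    ncWord k a * s * ncWord k b - ncWord k a' * s' * ncWord k b' ∈
      trivialSubmodule lt S (a * t * b)

/-- Both products are compared with `s m s'`: the first differs from it by `s m (s' - t')` and the
second by `(s - t) m s'`, and since `s` and `s'` are monic these corrections involve only words
smaller than `t'` and `t`. -/
theorem disjoint_mem_trivialSubmodule (hlt : RewriteOrder lt) {s s' : NCPoly k X} (hs : s ∈ S)
    (hs' : s' ∈ S) {t t' : FreeMonoid X} (ht : IsLeadingWord lt s t)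
    (ht' : IsLeadingWord lt s' t') (h1 : s.coeff t = 1) (h1' : s'.coeff t' = 1)
    (m : FreeMonoid X) :
    s * ncWord k (m * t') - ncWord k (t * m) * s' ∈ trivialSubmodule lt S (t * m * t') := by
  have hl := leadsTo_of_isLeadingWord ht
  have hl' := leadsTo_of_isLeadingWord ht'
  rw [h1, LeadsTo, one_smul] at hl
  rw [h1', LeadsTo, one_smul] at hl'
  have key : s * ncWord k (m * t') - ncWord k (t * m) * s' =
      (s - ncWord k t) * (ncWord k m * s') - (s * ncWord k m) * (s' - ncWord k t') := by
    simp only [ncWord_mul]; noncomm_ring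
  rw [key]
  refine sub_mem ?_ ?_
  · refine map_mem_of_wordSpan (LinearMap.mulRight k (ncWord k m * s')) (fun v hv => ?_) hl
    have := generator_mem_trivialSubmodule hs' ht' (v * m) 1 (w := t * m * t')
      (by simpa [mul_assoc] using hlt.mul_right (m * t') hv)
    simpa only [ncWord_mul, ncWord_one, mul_assoc, one_mul, mul_one, LinearMap.mulRight_apply,
      LinearMap.mulLeft_apply] using this
  · refine map_mem_of_wordSpan (LinearMap.mulLeft k (s * ncWord k m)) (fun v hv => ?_) hl'
    have := generator_mem_trivialSubmodule hs ht 1 (m * v) (w := t * m * t')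
      (by simpa [mul_assoc] using hlt.mul_left (t * m) hv)
    simpa only [ncWord_mul, ncWord_one, mul_assoc, one_mul, mul_one, LinearMap.mulRight_apply,
      LinearMap.mulLeft_apply] using this

/-- Two occurrences of leading words in one word are disjoint, nested or properly overlapping. The
last two cases are compositions multiplied by words on both sides; the first is always trivial. -/
theorem confluent_of_compositions (hlt : RewriteOrder lt)
    (monic : ∀ f ∈ S, ∀ t, IsLeadingWord lt f t → f.coeff t = 1)
    (inter : ∀ f ∈ S, ∀ g ∈ S, ∀ e c u : FreeMonoid X, IsLeadingWord lt f (e * c) →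
      IsLeadingWord lt g (c * u) → c ≠ 1 →
      f * ncWord k u - ncWord k e * g ∈ trivialSubmodule lt S (e * c * u))
    (incl : ∀ f ∈ S, ∀ g ∈ S, ∀ a q b : FreeMonoid X, IsLeadingWord lt f (a * q * b) →
      IsLeadingWord lt g q →
      f - ncWord k a * g * ncWord k b ∈ trivialSubmodule lt S (a * q * b)) :
    Confluent lt S := by
  -- By symmetry it suffices to treat the case where the first occurrence starts no later than the
  -- second, that is, `a' = a * e`.
  have main : ∀ s ∈ S, ∀ s' ∈ S, ∀ a t b e t' b' : FreeMonoid X, IsLeadingWord lt s t →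
    IsLeadingWord lt s' t' → a * t * b = a * e * t' * b' →
    ncWord k a * s * ncWord k b - ncWord k (a * e) * s' * ncWord k b' ∈
      trivialSubmodule lt S (a * t * b) := by
    intro s hs s' hs' a t b e t' b' ht ht' h
    have h' : t * b = e * (t' * b') := by
      have : a * (t * b) = a * (e * (t' * b')) := by simpa [mul_assoc] using h
      exact List.append_cancel_left this
    rcases FreeMonoid.mul_eq_mul_cases h' with ⟨m, rfl, rfl⟩ | ⟨c, rfl, hc⟩
    · have := mul_mem_trivialSubmodule hlt (disjoint_mem_trivialSubmodule hlt hs hs' ht ht'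
        (monic s hs t ht) (monic s' hs' t' ht') m) a b'
      simpa only [ncWord_mul, mul_assoc, mul_sub, sub_mul] using this
    · rcases FreeMonoid.mul_eq_mul_cases hc with ⟨b'', rfl, rfl⟩ | ⟨u, rfl, rfl⟩
      · have := mul_mem_trivialSubmodule hlt (incl s hs s' hs' e t' b'' (by rwa [mul_assoc]) ht')
          a b
        simpa only [ncWord_mul, mul_assoc, mul_sub, sub_mul] using this
      · by_cases hc1 : c = 1
        · subst hc1
          have := mul_mem_trivialSubmodule hlt (disjoint_mem_trivialSubmodule hlt hs hs' ht ht'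
            (monic s hs _ ht) (monic s' hs' _ ht') 1) a b'
          simpa only [ncWord_mul, ncWord_one, one_mul, mul_one, mul_assoc, mul_sub, sub_mul] using this
        · have := mul_mem_trivialSubmodule hlt (inter s hs s' hs' e c u ht ht' hc1) a b'
          simpa only [ncWord_mul, mul_assoc, mul_sub, sub_mul] using this
  intro s hs s' hs' a t b a' t' b' ht ht' h
  have h' : a * (t * b) = a' * (t' * b') := by simpa [mul_assoc] using h
  rcases FreeMonoid.mul_eq_mul_cases h' with ⟨e, rfl, -⟩ | ⟨e, rfl, -⟩
  · exact main s hs s' hs' a t b e t' b' ht ht' h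
  · have := main s' hs' s hs a' t' b' e t b ht' ht h.symm
    rw [← h] at this
    rw [← neg_sub]
    exact neg_mem this

/-- The words containing no leading word of an element of `S`. -/
def irreducibleWords (lt : FreeMonoid X → FreeMonoid X → Prop) (S : Set (NCPoly k X)) :
    Set (FreeMonoid X) :=
  {z | ∀ s ∈ S, ∀ t, IsLeadingWord lt s t → ∀ a b : FreeMonoid X, z ≠ a * t * b}

/-- The linear extension of a map defined on words. -/
def wordExtend {M : Type*} [AddCommGroup M] [Module k M] (F : FreeMonoid X → M) :
    NCPoly k X →ₗ[k] M :=
  (Finsupp.linearCombination k F).comp (MonoidAlgebra.coeffLinearEquiv k).toLinearMap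

theorem wordExtend_ncWord {M : Type*} [AddCommGroup M] [Module k M] (F : FreeMonoid X → M)
    (w : FreeMonoid X) : wordExtend F (ncWord k w) = F w := by
  simp [wordExtend]

open Classical in

/-- Every word has a normal form. -/
theorem exists_normalForm (hlt : RewriteOrder lt)
    (monic : ∀ f ∈ S, ∀ t, IsLeadingWord lt f t → f.coeff t = 1) (hS : Confluent lt S) :
    ∃ N : NCPoly k X →ₗ[k] NCPoly k X,
      (∀ s ∈ S, ∀ t, IsLeadingWord lt s t → ∀ a b : FreeMonoid X,
        N (ncWord k a * s * ncWord k b) = 0) ∧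
      (∀ w ∈ irreducibleWords lt S, N (ncWord k w) = ncWord k w) ∧
      (∀ w, N (ncWord k w) ∈ wordSpan k {v | v = w ∨ lt v w}) := by
  let red (w : FreeMonoid X) : Prop := ∃ r : NCPoly k X, (∃ s ∈ S, ∃ t a b, IsLeadingWord lt s t ∧
    w = a * t * b ∧ r = ncWord k w - ncWord k a * s * ncWord k b)
  -- The normal form of a reducible word is that of the remainder of one chosen reduction. The value
  -- `0` off the smaller words is never used, since the remainder involves only smaller words
  -- (`hlow`, `hext`).
  let step (w : FreeMonoid X) (ih : ∀ v, lt v w → NCPoly k X) : NCPoly k X :=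
    if h : red w then wordExtend (fun v => if hv : lt v w then ih v hv else 0) h.choose
    else ncWord k w
  let F : FreeMonoid X → NCPoly k X := hlt.wf.fix step
  have hF : ∀ w, F w = step w fun v _ => F v := fun w => hlt.wf.fix_eq step w
  have hlow : ∀ s ∈ S, ∀ t, IsLeadingWord lt s t → ∀ a b : FreeMonoid X,
      ncWord k (a * t * b) - ncWord k a * s * ncWord k b ∈ wordSpan k {v | lt v (a * t * b)} := by
    intro s hs t ht a b
    have h := leadsTo_of_isLeadingWord ht
    rw [monic s hs t ht, LeadsTo, one_smul] at h
    rw [← neg_sub]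
    refine neg_mem ?_
    have h2 : ncWord k a * s * ncWord k b - ncWord k (a * t * b) =
        ncWord k a * (s - ncWord k t) * ncWord k b := by
      simp only [ncWord_mul, mul_sub, sub_mul]
    rw [h2]
    refine mul_mem_wordSpan (s := {v | lt v (a * t)}) (t := {b}) ?_
      (mul_mem_wordSpan (s := {a}) (t := {v | lt v t}) ?_ (ncWord_mem_wordSpan rfl) h)
      (ncWord_mem_wordSpan rfl)
    · rintro u hu v rfl
      exact hlt.mul_right _ hu
    · rintro u rfl v hv
      exact hlt.mul_left _ hv
  have hext : ∀ (w : FreeMonoid X) (f : NCPoly k X), f ∈ wordSpan k {v | lt v w} →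
      wordExtend (fun v => if lt v w then F v else 0) f = wordExtend F f := by
    intro w f hf
    have := map_mem_of_wordSpan (P := ⊥)
      (wordExtend (fun v => if lt v w then F v else 0) - wordExtend F) (fun v hv => ?_) hf
    · simpa [sub_eq_zero] using this
    · have hv' : lt v w := hv
      simp only [LinearMap.sub_apply, wordExtend_ncWord, if_pos hv', sub_self]
      exact zero_mem _
  have hred : ∀ w, red w → ∃ s ∈ S, ∃ t a b, IsLeadingWord lt s t ∧ w = a * t * b ∧
      F w = wordExtend F (ncWord k w - ncWord k a * s * ncWord k b) := by
    intro w h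
    obtain ⟨s, hs, t, a, b, ht, hw, hr⟩ := h.choose_spec
    refine ⟨s, hs, t, a, b, ht, hw, ?_⟩
    rw [hF]
    simp only [step, dif_pos h]
    rw [← hr]
    simp only [dite_eq_ite]
    apply hext
    rw [hr]
    subst hw
    exact hlow s hs t ht a b
  refine ⟨wordExtend F, ?_, ?_, ?_⟩
  -- The map kills the reduction chosen for `w` by construction. Any other reduction of `w` differs
  -- from it, by confluence, by multiples of `S` with smaller leading words, which are killed by
  -- induction.
  · have key : ∀ w, ∀ s ∈ S, ∀ t, IsLeadingWord lt s t → ∀ a b : FreeMonoid X, w = a * t * b →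
        wordExtend F (ncWord k a * s * ncWord k b) = 0 := by
      intro w
      induction w using hlt.wf.induction with
      | _ w ih =>
        intro s hs t ht a b hw
        obtain ⟨s', hs', t', a', b', ht', hw', hF'⟩ := hred w ⟨_, s, hs, t, a, b, ht, hw, rfl⟩
        rw [map_sub, wordExtend_ncWord, eq_comm, sub_eq_self] at hF'
        have hle : trivialSubmodule lt S w ≤ LinearMap.ker (wordExtend (k := k) F) := by
          rw [trivialSubmodule, Submodule.span_le]
          rintro _ ⟨s, hs, a, b, t, ht, h, rfl⟩
          exact ih _ h s hs t ht a b rfl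
        have hc := hS s hs s' hs' a t b a' t' b' ht ht' (hw ▸ hw')
        rw [← hw] at hc
        have := hle hc
        rwa [LinearMap.mem_ker, map_sub, hF', sub_zero] at this
    exact fun s hs t ht a b => key _ s hs t ht a b rfl
  · intro w hw
    rw [wordExtend_ncWord, hF]
    have : ¬ red w := by
      rintro ⟨r, s, hs, t, a, b, ht, h, -⟩
      exact hw s hs t ht a b h
    simp only [step, dif_neg this]
  · intro w
    induction w using hlt.wf.induction with
    | _ w ih =>
      rw [wordExtend_ncWord]
      by_cases h : red w
      · obtain ⟨s, hs, t, a, b, ht, hw, hF'⟩ := hred w h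
        rw [hF']
        refine wordSpan_mono (s := {v | lt v w}) (fun v hv => Or.inr hv) ?_
        have := hlow s hs t ht a b
        rw [← hw] at this
        refine map_mem_of_wordSpan _ (fun v hv => ?_) this
        refine wordSpan_mono ?_ (ih v hv)
        rintro u (rfl | hu)
        · exact hv
        · exact hlt.trans hu hv
      · rw [hF]
        simp only [step, dif_neg h]
        exact ncWord_mem_wordSpan (Or.inl rfl)

end Diamond

/-! ### Copies of a Gröbner–Shirshov basis under maps of letters -/

/-- The algebra homomorphism of noncommutative polynomials induced by a map of letters. -/
def letterHom (k : Type u) {X Z : Type u} [Field k] (g : X → Z) : NCPoly k X →ₐ[k] NCPoly k Z :=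
  MonoidAlgebra.mapDomainAlgHom k k (FreeMonoid.map g)

theorem letterHom_ncWord (g : X → Z) (w : FreeMonoid X) :
    letterHom k g (ncWord k w) = ncWord k (FreeMonoid.map g w) := by
  simp [letterHom]

theorem map_injective {g : X → Z} (hg : Function.Injective g) :
    Function.Injective (FreeMonoid.map g) :=
  List.map_injective_iff.2 hg

theorem map_eq_mul {g : X → Z} {w : FreeMonoid X} {p q : FreeMonoid Z}
    (h : FreeMonoid.map g w = p * q) :
    ∃ p' q', w = p' * q' ∧ FreeMonoid.map g p' = p ∧ FreeMonoid.map g q' = q :=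
  List.map_eq_append_iff.1 h

theorem coeff_letterHom_map {g : X → Z} (hg : Function.Injective g) (f : NCPoly k X)
    (w : FreeMonoid X) : (letterHom k g f).coeff (FreeMonoid.map g w) = f.coeff w :=
  Finsupp.mapDomain_apply (map_injective hg) f.coeff w

theorem letterHom_mem_wordSpan (g : X → Z) {s : Set (FreeMonoid X)} {r : Set (FreeMonoid Z)}
    (h : ∀ w ∈ s, FreeMonoid.map g w ∈ r) {f : NCPoly k X} (hf : f ∈ wordSpan k s) :
    letterHom k g f ∈ wordSpan k r :=
  map_mem_of_wordSpan (letterHom k g).toLinearMap (fun v hv => by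
    simpa only [AlgHom.toLinearMap_apply, letterHom_ncWord] using ncWord_mem_wordSpan (h v hv)) hf

theorem isLeadingWord_letterHom {lt : FreeMonoid X → FreeMonoid X → Prop}
    {lt' : FreeMonoid Z → FreeMonoid Z → Prop} {g : X → Z} (hg : Function.Injective g)
    (hlt : ∀ u v, lt u v → lt' (FreeMonoid.map g u) (FreeMonoid.map g v)) {f : NCPoly k X}
    {t : FreeMonoid X} (h : IsLeadingWord lt f t) :
    IsLeadingWord lt' (letterHom k g f) (FreeMonoid.map g t) := by
  refine ⟨by rw [coeff_letterHom_map hg]; exact h.1, fun v hv hne => ?_⟩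
  have : letterHom k g f ∈ wordSpan k {v | ∃ w, f.coeff w ≠ 0 ∧ FreeMonoid.map g w = v} :=
    letterHom_mem_wordSpan g (s := {w | f.coeff w ≠ 0})
      (r := {v | ∃ w, f.coeff w ≠ 0 ∧ FreeMonoid.map g w = v}) (fun w hw => ⟨w, hw, rfl⟩)
      (mem_wordSpan_iff.2 fun _ h => h)
  obtain ⟨w, hw, rfl⟩ := mem_wordSpan_iff.1 this v hv
  exact hlt _ _ (h.2 w hw fun e => hne (e ▸ rfl))

theorem isLeadingWord_unique {lt : FreeMonoid X → FreeMonoid X → Prop}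
    (hlt : ∀ u v, lt u v → ¬ lt v u) {f : NCPoly k X} {t t' : FreeMonoid X}
    (h : IsLeadingWord lt f t) (h' : IsLeadingWord lt f t') : t = t' := by
  by_contra hne
  exact hlt _ _ (h.2 t' h'.1 (Ne.symm hne)) (h'.2 t h.1 hne)

theorem rewriteOrder_of_wordOrder (ord : WordOrder X) : RewriteOrder ord.lt where
  wf := ord.isWellOrder.wf
  trans := fun h h' => by
    have := ord.isWellOrder
    exact _root_.trans h h'
  mul := fun a _ _ b h => ord.mul_lt_mul a _ _ b h

theorem RewriteOrder.asymm {lt : FreeMonoid X → FreeMonoid X → Prop} (h : RewriteOrder lt) :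
    ∀ u v, lt u v → ¬ lt v u :=
  fun u v => h.wf.asymmetric u v

/-- The union of the images of `S` under a family of maps of letters. -/
def copies {J : Type*} (ι : J → X → Z) (S : Set (NCPoly k X)) : Set (NCPoly k Z) :=
  {f | ∃ j, ∃ s ∈ S, letterHom k (ι j) s = f}

theorem letterHom_mem_copies {J : Type*} (ι : J → X → Z) {S : Set (NCPoly k X)} (j : J)
    {s : NCPoly k X} (hs : s ∈ S) : letterHom k (ι j) s ∈ copies ι S :=
  ⟨j, s, hs, rfl⟩

section Copies

variable {J : Type*} {ι : J → X → Z} {S : Set (NCPoly k X)} {ord : WordOrder X}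
  {lt : FreeMonoid Z → FreeMonoid Z → Prop}

theorem monic_of_isGSBasis (hS : IsGSBasis ord S) {s : NCPoly k X} (hs : s ∈ S)
    {t : FreeMonoid X} (ht : IsLeadingWord ord.lt s t) : s.coeff t = 1 := by
  obtain ⟨t', ht', h1⟩ := hS.monic s hs
  rwa [isLeadingWord_unique (rewriteOrder_of_wordOrder ord).asymm ht ht']

theorem leadingWord_copy (hlt : RewriteOrder lt) (hinj : ∀ j, Function.Injective (ι j))
    (hmono : ∀ j u v, ord.lt u v → lt (FreeMonoid.map (ι j) u) (FreeMonoid.map (ι j) v))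
    (hS : IsGSBasis ord S) {s : NCPoly k X} (hs : s ∈ S) {j : J} {p : FreeMonoid Z}
    (hp : IsLeadingWord lt (letterHom k (ι j) s) p) :
    ∃ t, IsLeadingWord ord.lt s t ∧ FreeMonoid.map (ι j) t = p := by
  obtain ⟨t, ht, -⟩ := hS.monic s hs
  exact ⟨t, ht, isLeadingWord_unique hlt.asymm (isLeadingWord_letterHom (hinj j) (hmono j) ht) hp⟩

theorem letterHom_mem_trivialSubmodule (hinj : ∀ j, Function.Injective (ι j))
    (hmono : ∀ j u v, ord.lt u v → lt (FreeMonoid.map (ι j) u) (FreeMonoid.map (ι j) v))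
    (j : J) {w : FreeMonoid X} {f : NCPoly k X} (hf : TrivialModulo ord.lt S w f) :
    letterHom k (ι j) f ∈ trivialSubmodule lt (copies ι S) (FreeMonoid.map (ι j) w) := by
  have : trivialSubmodule ord.lt S w ≤
      (trivialSubmodule lt (copies ι S) (FreeMonoid.map (ι j) w)).comap
        (letterHom k (ι j)).toLinearMap := by
    rw [trivialSubmodule, Submodule.span_le]
    rintro _ ⟨s, hs, a, b, t, ht, h, rfl⟩
    rw [SetLike.mem_coe, Submodule.mem_comap, AlgHom.toLinearMap_apply, map_mul, map_mul,
      letterHom_ncWord, letterHom_ncWord]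
    refine generator_mem_trivialSubmodule (letterHom_mem_copies ι j hs)
      (isLeadingWord_letterHom (hinj j) (hmono j) ht) _ _ ?_
    rw [← map_mul, ← map_mul]
    exact hmono j _ _ h
  exact this hf

theorem eq_of_map_eq_map (hdisj : ∀ j j' x x', ι j x = ι j' x' → j = j') {j j' : J}
    {c c' : FreeMonoid X} (h : FreeMonoid.map (ι j) c = FreeMonoid.map (ι j') c')
    (hc : FreeMonoid.map (ι j) c ≠ 1) : j = j' := by
  cases c using FreeMonoid.casesOn with
  | one => exact absurd (map_one _) hc
  | of_mul x c =>
    cases c' using FreeMonoid.casesOn with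
    | one => exact absurd (h.trans (map_one _)) hc
    | of_mul x' c' => exact hdisj _ _ _ _ (List.cons.inj h).1

/-- A union of disjoint copies of a Gröbner–Shirshov basis is confluent. -/
theorem confluent_copies (hlt : RewriteOrder lt) (hinj : ∀ j, Function.Injective (ι j))
    (hdisj : ∀ j j' x x', ι j x = ι j' x' → j = j')
    (hmono : ∀ j u v, ord.lt u v → lt (FreeMonoid.map (ι j) u) (FreeMonoid.map (ι j) v))
    (hS : IsGSBasis ord S) (h1 : ∀ s ∈ S, ¬ IsLeadingWord ord.lt s 1) :
    (∀ f ∈ copies ι S, ∀ t, IsLeadingWord lt f t → f.coeff t = 1) ∧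
      Confluent lt (copies ι S) := by
  have monic : ∀ f ∈ copies ι S, ∀ t, IsLeadingWord lt f t → f.coeff t = 1 := by
    rintro _ ⟨j, s, hs, rfl⟩ p hp
    obtain ⟨t, ht, rfl⟩ := leadingWord_copy hlt hinj hmono hS hs hp
    rw [coeff_letterHom_map (hinj j)]
    exact monic_of_isGSBasis hS hs ht
  refine ⟨monic, confluent_of_compositions hlt monic ?_ ?_⟩
  · rintro _ ⟨j, s, hs, rfl⟩ _ ⟨j', s', hs', rfl⟩ e c u hp hq hc
    obtain ⟨t, ht, h⟩ := leadingWord_copy hlt hinj hmono hS hs hp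
    obtain ⟨t', ht', h'⟩ := leadingWord_copy hlt hinj hmono hS hs' hq
    obtain ⟨e, c, rfl, rfl, rfl⟩ := map_eq_mul h
    obtain ⟨c', u, rfl, hcc, rfl⟩ := map_eq_mul h'
    -- The overlap is nonempty, so the two copies share a letter and coincide; the composition is
    -- then the image of one in `S`.
    obtain rfl := eq_of_map_eq_map hdisj hcc (by rw [hcc]; exact hc)
    obtain rfl := map_injective (hinj j') hcc
    have := letterHom_mem_trivialSubmodule hinj hmono j'
      (hS.intersection s hs s' hs' (e * c') (c' * u) u e (e * c' * u) ht ht' rfl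
        (mul_assoc _ _ _) ?_)
    · simpa only [map_sub, map_mul, letterHom_ncWord] using this
    · have : c'.length ≠ 0 := fun h0 => hc (by rw [FreeMonoid.length_eq_zero.1 h0, map_one])
      simp only [FreeMonoid.length_mul]
      omega
  · rintro _ ⟨j, s, hs, rfl⟩ _ ⟨j', s', hs', rfl⟩ a q b hp hq
    obtain ⟨t, ht, h⟩ := leadingWord_copy hlt hinj hmono hS hs hp
    obtain ⟨t', ht', h'⟩ := leadingWord_copy hlt hinj hmono hS hs' hq
    obtain ⟨aq, b, rfl, haq, rfl⟩ := map_eq_mul h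
    obtain ⟨a, q, rfl, rfl, rfl⟩ := map_eq_mul haq
    -- Here the common letter comes from the inner leading word, which is nonempty by `h1`.
    obtain rfl := eq_of_map_eq_map hdisj h' (fun h0 : FreeMonoid.map (ι j') t' = 1 => h1 s' hs' (by
      have h0' : t' = 1 := List.map_eq_nil_iff.1 h0
      rwa [h0'] at ht'))
    obtain rfl := map_injective (hinj j') h'
    have := letterHom_mem_trivialSubmodule hinj hmono j'
      (hS.inclusion s hs s' hs' a b t' (a * t' * b) ht ht' rfl)
    simpa only [map_sub, map_mul, letterHom_ncWord] using this

end Copies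

/-! ### Triangular families and linear independence -/

/-- The order need not be total. Among the finitely many indices with nonzero coefficient, choose
one with `p i` maximal; then `p i` occurs in no other `G j` of the relation, and its coefficient `g
i * c i` cannot cancel. -/
theorem linearIndependent_of_leadsTo {I : Type*} {lt : FreeMonoid Z → FreeMonoid Z → Prop}
    (hlt : RewriteOrder lt) {G : I → NCPoly k Z} {p : I → FreeMonoid Z} {c : I → k}
    (hp : Function.Injective p) (hc : ∀ i, c i ≠ 0) (hG : ∀ i, LeadsTo lt (G i) (p i) (c i)) :
    LinearIndependent k G := by
  classical
  rw [linearIndependent_iff']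
  intro s g hsum
  by_contra! hne
  obtain ⟨i₀, hi₀, hg₀⟩ := hne
  let T := {i // i ∈ s ∧ g i ≠ 0}
  have : Finite T := Set.Finite.subset s.finite_toSet (fun i hi => hi.1)
  let r : T → T → Prop := fun i j => lt (p j) (p i)
  have htr : IsTrans T r := ⟨fun a b c hab hbc => hlt.trans hbc hab⟩
  have hir : Std.Irrefl r := ⟨fun a => hlt.irrefl _⟩
  obtain ⟨⟨i, his, hgi⟩, -, hmax⟩ :=
    (Finite.wellFounded_of_trans_of_irrefl r).has_min Set.univ ⟨⟨i₀, hi₀, hg₀⟩, trivial⟩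
  have hcoeff : ∀ j ∈ s, g j ≠ 0 → ((G j).coeff (p i) = if j = i then c i else 0) := by
    intro j hj hgj
    have h0 : (G j - c j • ncWord k (p j)).coeff (p i) = 0 := by
      by_contra hcon
      exact hmax ⟨j, hj, hgj⟩ trivial (mem_wordSpan_iff.1 (hG j) _ hcon)
    have h1 : (G j).coeff (p i) = c j * (ncWord k (p j)).coeff (p i) := by
      rwa [MonoidAlgebra.coeff_sub, Finsupp.sub_apply, MonoidAlgebra.coeff_smul_apply, sub_eq_zero]
        at h0
    rw [h1]
    split_ifs with h
    · subst h
      rw [coeff_ncWord_self, mul_one]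
    · rw [coeff_ncWord_ne (fun e => h (hp e)), mul_zero]
  have h2 : (∑ j ∈ s, g j • G j).coeff (p i) = g i * c i := by
    rw [MonoidAlgebra.coeff_sum, Finsupp.finsetSum_apply, Finset.sum_eq_single_of_mem i his]
    · rw [MonoidAlgebra.coeff_smul_apply, hcoeff i his hgi, if_pos rfl, smul_eq_mul]
    · intro j hj hji
      rw [MonoidAlgebra.coeff_smul_apply]
      by_cases hgj : g j = 0
      · rw [hgj, zero_smul]
      · rw [hcoeff j hj hgj, if_neg hji, smul_zero]
  rw [hsum] at h2
  exact mul_ne_zero hgi (hc i) h2.symm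

/-- `N` is linear but not multiplicative, so the ideal is described additively by the products `a s
b` with polynomials `a`, `b`, which are then expanded into words. -/
theorem span_le_ker_normalForm {lt : FreeMonoid Z → FreeMonoid Z → Prop} {S : Set (NCPoly k Z)}
    (hlead : ∀ s ∈ S, ∃ t, IsLeadingWord lt s t) {N : NCPoly k Z →ₗ[k] NCPoly k Z}
    (hN : ∀ s ∈ S, ∀ t, IsLeadingWord lt s t → ∀ a b : FreeMonoid Z,
        N (ncWord k a * s * ncWord k b) = 0)
    {f : NCPoly k Z} (hf : f ∈ TwoSidedIdeal.span S) : N f = 0 := by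
  rw [TwoSidedIdeal.mem_span_iff_mem_addSubgroup_closure] at hf
  induction hf using AddSubgroup.closure_induction with
  | mem x hx =>
    obtain ⟨_, ⟨a, -, s, hs, rfl⟩, b, -, rfl⟩ := hx
    obtain ⟨t, ht⟩ := hlead s hs
    refine map_mem_of_wordSpan (P := ⊥)
      (N.comp ((LinearMap.mulRight k b).comp (LinearMap.mulRight k s))) (fun u _ => ?_)
      (mem_wordSpan_univ a)
    refine map_mem_of_wordSpan (P := ⊥)
      (N.comp (LinearMap.mulLeft k (ncWord k u * s))) (fun v _ => ?_) (mem_wordSpan_univ b)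
    exact hN s hs t ht u v
  | zero => exact map_zero _
  | add x y _ _ hx hy => rw [map_add, hx, hy, add_zero]
  | neg x _ hx => rw [map_neg, hx, neg_zero]

/-- Evaluation of words in the letters `Y` at noncommutative polynomials in the letters `Z`. -/
theorem leadsTo_lift {Y : Type u} {lt : FreeMonoid Z → FreeMonoid Z → Prop}
    (hlt : RewriteOrder lt) (e : Y → NCPoly k Z) (L : FreeMonoid Y →* FreeMonoid Z) (c : Y → k)
    (h : ∀ y, LeadsTo lt (e y) (L (FreeMonoid.of y)) (c y)) (w : FreeMonoid Y) :
    LeadsTo lt (FreeMonoid.lift e w) (L w) (FreeMonoid.lift c w) := by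
  induction w using FreeMonoid.inductionOn' with
  | one =>
    simp only [map_one]
    exact leadsTo_one lt
  | of_mul y w ih =>
    simp only [map_mul, FreeMonoid.lift_eval_of]
    exact (h y).mul hlt ih

theorem lift_ne_zero {Y : Type u} {c : Y → k} (hc : ∀ y, c y ≠ 0) (w : FreeMonoid Y) :
    FreeMonoid.lift c w ≠ 0 := by
  induction w using FreeMonoid.inductionOn' with
  | one => simp
  | of_mul y w ih =>
    rw [map_mul, FreeMonoid.lift_eval_of]
    exact mul_ne_zero (hc y) ih

/-- Words whose evaluations have distinct irreducible leading words are linearly independent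
modulo the ideal of a confluent set. -/
theorem linearIndependent_lift {Y R : Type u} [Ring R] [Algebra k R]
    {lt : FreeMonoid Z → FreeMonoid Z → Prop} (hlt : RewriteOrder lt) {S : Set (NCPoly k Z)}
    (hlead : ∀ s ∈ S, ∃ t, IsLeadingWord lt s t)
    (monic : ∀ f ∈ S, ∀ t, IsLeadingWord lt f t → f.coeff t = 1) (hS : Confluent lt S)
    (q : NCPoly k Z →ₐ[k] R) (hq : ∀ f, q f = 0 → f ∈ TwoSidedIdeal.span S)
    (e : Y → NCPoly k Z) (L : FreeMonoid Y →* FreeMonoid Z) (hL : Function.Injective L)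
    (c : Y → k) (hc : ∀ y, c y ≠ 0) (h : ∀ y, LeadsTo lt (e y) (L (FreeMonoid.of y)) (c y))
    (B : Set (FreeMonoid Y)) (hB : ∀ z ∈ B, L z ∈ irreducibleWords lt S) :
    LinearIndependent k fun z : B => q (FreeMonoid.lift e z.1) := by
  obtain ⟨N, hN0, hNirr, hNle⟩ := exists_normalForm hlt monic hS
  -- `N` fixes the irreducible word `L z` and sends smaller words to combinations of smaller words,
  -- so the normal forms are still triangular with leading words `L z`.
  have hind : LinearIndependent k fun z : B => N (FreeMonoid.lift e z.1) := by
    refine linearIndependent_of_leadsTo hlt (p := fun z : B => L z.1)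
      (c := fun z => FreeMonoid.lift c z.1) (fun z z' hz => Subtype.ext (hL hz))
      (fun z => lift_ne_zero hc z.1) fun z => ?_
    have h1 := leadsTo_lift hlt e L c h z.1
    have h2 := map_mem_of_wordSpan (P := wordSpan k {v | lt v (L z.1)}) N (fun v hv => by
      refine wordSpan_mono ?_ (hNle v)
      rintro u (rfl | hu)
      · exact hv
      · exact hlt.trans hu hv) h1
    rwa [map_sub, map_smul, hNirr _ (hB z.1 z.2)] at h2
  rw [linearIndependent_iff] at hind ⊢
  intro l hl
  refine hind l ?_
  -- A relation in `R` lifts to an element of the ideal, and `N` turns it into a relation between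
  -- the normal forms.
  have h3 : q (Finsupp.linearCombination k (fun z : B => FreeMonoid.lift e z.1) l) = 0 := by
    rw [← hl]
    exact Finsupp.apply_linearCombination k q.toLinearMap _ l
  have h4 := span_le_ker_normalForm hlead hN0 (hq _ h3)
  rw [← h4]
  exact (Finsupp.apply_linearCombination k N _ l).symm

/-! ### Differential algebras containing a given algebra -/

theorem exists_algHom_of_surjective {P A R : Type*} [Ring P] [Algebra k P] [Ring A] [Algebra k A]
    [Ring R] [Algebra k R] {π : P →ₐ[k] A} (hπ : Function.Surjective π) (g : P →ₐ[k] R)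
    (hg : ∀ f, π f = 0 → g f = 0) : ∃ φ : A →ₐ[k] R, ∀ f, φ (π f) = g f := by
  have key : ∀ f f', π f = π f' → g f = g f' := fun f f' h =>
    sub_eq_zero.1 (by rw [← map_sub]; exact hg _ (by rw [map_sub, h, sub_self]))
  have hinv : ∀ a, π (Function.surjInv hπ a) = a := Function.surjInv_eq hπ
  refine ⟨AlgHom.ofLinearMap
    { toFun := fun a => g (Function.surjInv hπ a)
      map_add' := fun a b => by
        rw [← map_add]
        exact key _ _ (by simp only [map_add, hinv])
      map_smul' := fun c a => by
        rw [RingHom.id_apply, ← map_smul]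
        exact key _ _ (by simp only [map_smul, hinv]) } ?_ ?_, fun f => key _ _ (hinv _)⟩
  · exact (key _ 1 (by simp only [map_one, hinv])).trans (map_one g)
  · intro a b
    refine (key _ (Function.surjInv hπ a * Function.surjInv hπ b) ?_).trans (map_mul g _ _)
    simp only [map_mul, hinv]

theorem map_diffWordEval {D R : Type u} [Ring D] [Algebra k D] [Ring R] [Algebra k R]
    {d : D →ₗ[k] D} {dR : R →ₗ[k] R} (ψ : D →ₐ[k] R) (hψ : ∀ x, ψ (d x) = dR (ψ x))
    (e : X → D) (w : FreeMonoid (X × ℕ)) :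
    ψ (diffWordEval d e w) = diffWordEval dR (fun x => ψ (e x)) w := by
  have h : (ψ : D →* R).comp (diffWordEval d e) = diffWordEval dR (fun x => ψ (e x)) := by
    refine FreeMonoid.hom_eq fun p => ?_
    simp only [diffWordEval, MonoidHom.comp_apply, FreeMonoid.lift_eval_of]
    exact (Function.Semiconj.iterate_right (f := ψ) (ga := d) (gb := dR) hψ p.2) (e p.1)
  exact DFunLike.congr_fun h w

/-- If `A` maps to a differential algebra `R` presented by a confluent set, in which the values of
the words of `B` have distinct irreducible leading words, then these words are linearly
independent in the free differential algebra on `A`. -/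
theorem linearIndependent_diffWordEval {A D R : Type u} [Ring A] [Algebra k A] [Ring D]
    [Algebra k D] [Ring R] [Algebra k R] {lam : k} {d : D →ₗ[k] D} {i : A →ₐ[k] D}
    (hD : IsFreeDiffAlgebra lam d i) {π : NCPoly k X →ₐ[k] A} (hπ : Function.Surjective π)
    {dR : R →ₗ[k] R} (hdR : IsDiffOp lam dR)
    {lt : FreeMonoid Z → FreeMonoid Z → Prop} (hlt : RewriteOrder lt) {S : Set (NCPoly k Z)}
    (hlead : ∀ s ∈ S, ∃ t, IsLeadingWord lt s t)
    (monic : ∀ f ∈ S, ∀ t, IsLeadingWord lt f t → f.coeff t = 1) (hS : Confluent lt S)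
    (q : NCPoly k Z →ₐ[k] R) (hq : ∀ f, q f = 0 → f ∈ TwoSidedIdeal.span S)
    (dZ : NCPoly k Z →ₗ[k] NCPoly k Z) (hdZ : ∀ f, q (dZ f) = dR (q f))
    (g : X → Z) (hg : ∀ f, π f = 0 → q (letterHom k g f) = 0)
    (L : FreeMonoid (X × ℕ) →* FreeMonoid Z) (hL : Function.Injective L)
    (c : X × ℕ → k) (hc : ∀ y, c y ≠ 0)
    (h : ∀ p, LeadsTo lt (dZ^[p.2] (ncWord k (FreeMonoid.of (g p.1)))) (L (FreeMonoid.of p)) (c p))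
    (B : Set (FreeMonoid (X × ℕ))) (hB : ∀ z ∈ B, L z ∈ irreducibleWords lt S) :
    LinearIndependent k fun z : B =>
      diffWordEval d (fun x : X => i (π (ncWord k (FreeMonoid.of x)))) z.1 := by
  -- The map `A → R` extends to a differential homomorphism `ψ : D → R`, and independence of the
  -- images under `ψ` implies independence in `D`. The operator `dZ` serves only to lift `dR` to
  -- polynomials.
  obtain ⟨φ, hφ⟩ := exists_algHom_of_surjective hπ (q.comp (letterHom k g)) hg
  obtain ⟨ψ, ⟨hψd, hψi⟩, -⟩ := hD.universal R dR hdR φ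
  have hind := linearIndependent_lift hlt hlead monic hS q hq
    (fun p : X × ℕ => dZ^[p.2] (ncWord k (FreeMonoid.of (g p.1)))) L hL c hc h B hB
  refine LinearIndependent.of_comp ψ.toLinearMap ?_
  convert hind using 2 with z
  simp only [Function.comp_apply, AlgHom.toLinearMap_apply]
  rw [map_diffWordEval ψ hψd]
  have h2 : diffWordEval dR (fun x => ψ (i (π (ncWord k (FreeMonoid.of x))))) =
      (q : NCPoly k Z →* R).comp
        (FreeMonoid.lift fun p : X × ℕ => dZ^[p.2] (ncWord k (FreeMonoid.of (g p.1)))) := by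
    refine FreeMonoid.hom_eq fun p => ?_
    simp only [diffWordEval, MonoidHom.comp_apply, FreeMonoid.lift_eval_of]
    rw [← AlgHom.comp_apply ψ i, hψi, hφ, AlgHom.comp_apply, letterHom_ncWord]
    exact ((Function.Semiconj.iterate_right (f := q) (ga := dZ) (gb := dR) hdZ p.2) _).symm
  exact DFunLike.congr_fun h2 z.1

/-! ### Orders comparing words by families of subwords -/

/-- Compare two elements at the last index at which the associated words differ. -/
def colexLT (ord : WordOrder X) {M : Type*} (c : M → ℕ → FreeMonoid X) (w w' : M) : Prop :=
  ∃ n, ord.lt (c w n) (c w' n) ∧ ∀ m, n < m → c w m = c w' m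

theorem not_lt_one (ord : WordOrder X) (w : FreeMonoid X) : ¬ ord.lt w 1 := by
  intro h
  rcases eq_or_ne w 1 with rfl | hw
  · exact (rewriteOrder_of_wordOrder ord).irrefl _ h
  · exact (rewriteOrder_of_wordOrder ord).asymm _ _ h (ord.one_lt w hw)

theorem colexLT_trans {ord : WordOrder X} {M : Type*} {c : M → ℕ → FreeMonoid X} {u v w : M}
    (h : colexLT ord c u v) (h' : colexLT ord c v w) : colexLT ord c u w := by
  obtain ⟨n, hn, hm⟩ := h
  obtain ⟨n', hn', hm'⟩ := h'
  rcases lt_trichotomy n n' with h | rfl | h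
  · exact ⟨n', by rwa [hm n' h], fun m hlt => (hm m (h.trans hlt)).trans (hm' m hlt)⟩
  · exact ⟨n, (rewriteOrder_of_wordOrder ord).trans hn hn',
      fun m hlt => (hm m hlt).trans (hm' m hlt)⟩
  · exact ⟨n, by rwa [← hm' n h], fun m hlt => (hm m hlt).trans (hm' m (h.trans hlt))⟩

/-- Below a fixed `w` only finitely many coordinates matter: where `w` has trivial components
nothing is smaller, because `1` is the least word. What remains is a lexicographic order on finitely
many well-ordered coordinates. -/
theorem colexLT_wf (ord : WordOrder X) {M : Type*} (c : M → ℕ → FreeMonoid X)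
    (hfin : ∀ w, ∃ N, ∀ n, N ≤ n → c w n = 1) : WellFounded (colexLT ord c) := by
  -- It suffices for accessibility of `w` that everything below `w` through a last difference at an
  -- index at least `N` be accessible. Passing from `N` to `N + 1` costs a well-founded induction on
  -- the `N`-th coordinate.
  have key : ∀ N w, (∀ w', (∃ n, N ≤ n ∧ ord.lt (c w' n) (c w n) ∧ ∀ m, n < m → c w' m = c w m) →
      Acc (colexLT ord c) w') → Acc (colexLT ord c) w := by
    intro N
    induction N with
    | zero =>
      exact fun w h => Acc.intro w fun w' ⟨n, hn, hm⟩ => h w' ⟨n, Nat.zero_le n, hn, hm⟩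
    | succ N ih =>
      intro w h
      suffices H : ∀ p w', c w' N = p → (∀ m, N < m → c w' m = c w m) →
          Acc (colexLT ord c) w' from H _ w rfl fun _ _ => rfl
      intro p
      induction p using (rewriteOrder_of_wordOrder ord).wf.induction with
      | _ p ihp =>
        intro w' hp hw'
        refine ih w' fun w'' ⟨n, hNn, hn, hm⟩ => ?_
        rcases hNn.eq_or_lt with rfl | hlt
        · exact ihp _ (hp ▸ hn) w'' rfl fun m hlt => (hm m hlt).trans (hw' m hlt)
        · exact h w'' ⟨n, hlt, (by rwa [hw' n hlt] at hn),
            fun m hm' => (hm m hm').trans (hw' m (hlt.trans hm'))⟩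
  refine WellFounded.intro fun w => ?_
  obtain ⟨N, hN⟩ := hfin w
  refine key N w fun w' ⟨n, hle, hn, _⟩ => ?_
  rw [hN n hle] at hn
  exact absurd hn (not_lt_one ord _)

/-- The subword of the letters of level `n`. -/
def levelPart (n : ℕ) : FreeMonoid (X × ℕ) →* FreeMonoid X :=
  FreeMonoid.lift fun p => if p.2 = n then FreeMonoid.of p.1 else 1

theorem levelPart_of (n : ℕ) (p : X × ℕ) :
    levelPart n (FreeMonoid.of p) = if p.2 = n then FreeMonoid.of p.1 else 1 := by
  simp [levelPart]

/-- The order on differential words used for nonzero weight. -/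
def levelLT (ord : WordOrder X) : FreeMonoid (X × ℕ) → FreeMonoid (X × ℕ) → Prop :=
  colexLT ord fun w n => levelPart n w

/-- Compatibility with products is immediate because each `levelPart n` is a monoid homomorphism;
well-foundedness holds because a word has letters at finitely many levels only. -/
theorem levelLT_rewriteOrder (ord : WordOrder X) : RewriteOrder (levelLT ord) where
  wf := by
    refine colexLT_wf ord _ fun w => ?_
    induction w using FreeMonoid.inductionOn' with
    | one => exact ⟨0, fun n _ => map_one _⟩
    | of_mul p w ih =>
      obtain ⟨N, hN⟩ := ih
      refine ⟨max N (p.2 + 1), fun n hn => ?_⟩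
      simp only [map_mul, levelPart_of]
      rw [if_neg (by have := le_max_right N (p.2 + 1); omega), one_mul]
      exact hN n ((le_max_left _ _).trans hn)
  trans := colexLT_trans
  mul := by
    rintro a u v b ⟨n, hn, hm⟩
    refine ⟨n, ?_, fun m h => ?_⟩
    · simp only [map_mul]
      exact ord.mul_lt_mul _ _ _ _ hn
    · simp only [map_mul]
      rw [show levelPart m u = levelPart m v from hm m h]

theorem levelPart_map (n m : ℕ) (w : FreeMonoid X) :
    levelPart m (FreeMonoid.map (fun x => (x, n)) w) = if n = m then w else 1 := by
  induction w using FreeMonoid.inductionOn' with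
  | one => simp
  | of_mul x w ih =>
    rw [map_mul, map_mul, ih, FreeMonoid.map_of, levelPart_of]
    split_ifs <;> simp

theorem levelLT_map {ord : WordOrder X} (n : ℕ) {u v : FreeMonoid X} (h : ord.lt u v) :
    levelLT ord (FreeMonoid.map (fun x => (x, n)) u) (FreeMonoid.map (fun x => (x, n)) v) := by
  refine ⟨n, ?_, fun m hm => ?_⟩
  · simpa only [levelPart_map, if_true] using h
  · simp only [levelPart_map, if_neg hm.ne]

/-- The number of marks `none` in a word. -/
def markDeg (w : FreeMonoid (Option X)) : ℕ :=
  (FreeMonoid.toList w).countP Option.isNone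

theorem markDeg_mul (u v : FreeMonoid (Option X)) : markDeg (u * v) = markDeg u + markDeg v :=
  List.countP_append

/-- The `n`-th block of a word, the blocks being separated by the marks `none`. -/
def blockPartList : List (Option X) → ℕ → FreeMonoid X
  | [], _ => 1
  | some x :: l, 0 => FreeMonoid.of x * blockPartList l 0
  | some _ :: l, n + 1 => blockPartList l (n + 1)
  | none :: _, 0 => 1
  | none :: l, n + 1 => blockPartList l n

/-- The `n`-th block of a word, the blocks being separated by the marks `none`. -/
def blockPart (w : FreeMonoid (Option X)) (n : ℕ) : FreeMonoid X :=
  blockPartList (FreeMonoid.toList w) n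

theorem blockPart_one (n : ℕ) : blockPart (1 : FreeMonoid (Option X)) n = 1 := by
  simp [blockPart, blockPartList]

theorem blockPart_some_zero (x : X) (w : FreeMonoid (Option X)) :
    blockPart (FreeMonoid.of (some x) * w) 0 = FreeMonoid.of x * blockPart w 0 := by
  simp [blockPart, blockPartList]

theorem blockPart_some_succ (x : X) (w : FreeMonoid (Option X)) (n : ℕ) :
    blockPart (FreeMonoid.of (some x) * w) (n + 1) = blockPart w (n + 1) := by
  simp [blockPart, blockPartList]

theorem blockPart_none_zero (w : FreeMonoid (Option X)) :
    blockPart (FreeMonoid.of none * w) 0 = 1 := by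
  simp [blockPart, blockPartList]

theorem blockPart_none_succ (w : FreeMonoid (Option X)) (n : ℕ) :
    blockPart (FreeMonoid.of none * w) (n + 1) = blockPart w n := by
  simp [blockPart, blockPartList]

theorem markDeg_one : markDeg (1 : FreeMonoid (Option X)) = 0 := rfl

theorem markDeg_some (x : X) (w : FreeMonoid (Option X)) :
    markDeg (FreeMonoid.of (some x) * w) = markDeg w := by
  simp [markDeg]

theorem markDeg_none (w : FreeMonoid (Option X)) :
    markDeg (FreeMonoid.of none * w) = markDeg w + 1 := by
  simp [markDeg]

/-- The last block of `u`, with index `markDeg u`, is glued to block `0` of `v`. Before that index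
only `u` contributes; after it `blockPart u n` is `1`. -/
theorem blockPart_mul (u v : FreeMonoid (Option X)) (n : ℕ) :
    blockPart (u * v) n =
      blockPart u n * if markDeg u ≤ n then blockPart v (n - markDeg u) else 1 := by
  induction u using FreeMonoid.inductionOn' generalizing n with
  | one => simp [blockPart_one, markDeg_one]
  | of_mul o u ih =>
    rw [mul_assoc]
    cases o with
    | some x =>
      rw [markDeg_some]
      cases n with
      | zero => rw [blockPart_some_zero, blockPart_some_zero, ih, mul_assoc]
      | succ n => rw [blockPart_some_succ, blockPart_some_succ, ih]
    | none =>
      rw [markDeg_none]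
      cases n with
      | zero => rw [blockPart_none_zero, blockPart_none_zero, if_neg (by omega), one_mul]
      | succ n =>
        rw [blockPart_none_succ, blockPart_none_succ, ih, Nat.add_sub_add_right]
        simp only [Nat.add_le_add_iff_right]

theorem blockPart_eq_one {n : ℕ} {w : FreeMonoid (Option X)} (hn : markDeg w < n) :
    blockPart w n = 1 := by
  induction w using FreeMonoid.inductionOn' generalizing n with
  | one => exact blockPart_one n
  | of_mul o u ih =>
    cases n with
    | zero => omega
    | succ n =>
      cases o with
      | some x =>
        rw [markDeg_some] at hn
        rw [blockPart_some_succ]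
        exact ih hn
      | none =>
        rw [markDeg_none] at hn
        rw [blockPart_none_succ]
        exact ih (by omega)

/-- The order on marked words used for weight zero. -/
def blockLT (ord : WordOrder X) (w w' : FreeMonoid (Option X)) : Prop :=
  markDeg w = markDeg w' ∧ colexLT ord blockPart w w'

/-- Equality of `markDeg` in the definition of `blockLT` makes the blocks of a right factor `b`
start at the same index in both products. A left factor `a` moves the deciding block `n` to `n +
markDeg a`. -/
theorem blockLT_rewriteOrder (ord : WordOrder X) : RewriteOrder (blockLT ord) where
  wf := by
    refine Subrelation.wf (fun h => h.2) (colexLT_wf ord blockPart fun w => ?_)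
    exact ⟨markDeg w + 1, fun n hn => blockPart_eq_one hn⟩
  trans := fun h h' => ⟨h.1.trans h'.1, colexLT_trans h.2 h'.2⟩
  mul := by
    rintro a u v b ⟨hd, n, hn, hm⟩
    have hd' : markDeg (a * u) = markDeg (a * v) := by rw [markDeg_mul, markDeg_mul, hd]
    refine ⟨by rw [markDeg_mul, hd', ← markDeg_mul], n + markDeg a, ?_, fun m h => ?_⟩
    · rw [blockPart_mul _ b, blockPart_mul _ b, hd', blockPart_mul, blockPart_mul,
        if_pos (Nat.le_add_left _ _), if_pos (Nat.le_add_left _ _), Nat.add_sub_cancel]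
      exact ord.mul_lt_mul _ _ _ _ hn
    · rw [blockPart_mul _ b, blockPart_mul _ b, hd', blockPart_mul, blockPart_mul,
        hm (m - markDeg a) (by omega)]

theorem markDeg_map_some (w : FreeMonoid X) : markDeg (FreeMonoid.map some w) = 0 := by
  simp only [markDeg, FreeMonoid.toList_map, List.countP_map]
  exact List.countP_eq_zero.2 fun a _ => by simp

theorem blockPart_map_some (w : FreeMonoid X) (n : ℕ) :
    blockPart (FreeMonoid.map some w) n = if n = 0 then w else 1 := by
  induction w using FreeMonoid.inductionOn' with
  | one => simp [blockPart_one]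
  | of_mul x w ih =>
    rw [map_mul, FreeMonoid.map_of]
    cases n with
    | zero => rw [blockPart_some_zero, ih, if_pos rfl, if_pos rfl]
    | succ n => rw [blockPart_some_succ, ih, if_neg n.succ_ne_zero, if_neg n.succ_ne_zero]

theorem blockLT_map_some {ord : WordOrder X} {u v : FreeMonoid X} (h : ord.lt u v) :
    blockLT ord (FreeMonoid.map some u) (FreeMonoid.map some v) := by
  refine ⟨by rw [markDeg_map_some, markDeg_map_some], 0, ?_, fun m hm => ?_⟩
  · simpa only [blockPart_map_some, if_true] using h
  · rw [blockPart_map_some, blockPart_map_some, if_neg hm.ne', if_neg hm.ne']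

/-! ### Marked words -/

/-- The word in which the letter `x^{(n)}` is replaced by `x` preceded by `n` marks. -/
def markWord : FreeMonoid (X × ℕ) →* FreeMonoid (Option X) :=
  FreeMonoid.lift fun p => FreeMonoid.of none ^ p.2 * FreeMonoid.of (some p.1)

theorem markWord_of (p : X × ℕ) :
    markWord (FreeMonoid.of p) = FreeMonoid.of none ^ p.2 * FreeMonoid.of (some p.1) := by
  simp [markWord]

theorem of_mul_inj {a b : X} {u v : FreeMonoid X}
    (h : FreeMonoid.of a * u = FreeMonoid.of b * v) : a = b ∧ u = v :=
  List.cons.inj h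

theorem of_mul_ne_one (a : X) (u : FreeMonoid X) : FreeMonoid.of a * u ≠ 1 :=
  List.cons_ne_nil a u

theorem mark_pow_inj {n m : ℕ} {x y : X} {a b : FreeMonoid (Option X)}
    (h : FreeMonoid.of none ^ n * (FreeMonoid.of (some x) * a) =
      FreeMonoid.of none ^ m * (FreeMonoid.of (some y) * b)) : n = m ∧ x = y ∧ a = b := by
  induction n generalizing m with
  | zero =>
    cases m with
    | zero =>
      rw [pow_zero, one_mul, one_mul] at h
      obtain ⟨h1, h2⟩ := of_mul_inj h
      exact ⟨rfl, Option.some.inj h1, h2⟩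
    | succ m =>
      rw [pow_zero, one_mul, pow_succ', mul_assoc] at h
      exact absurd (of_mul_inj h).1 (by simp)
  | succ n ih =>
    cases m with
    | zero =>
      rw [pow_zero, one_mul, pow_succ', mul_assoc] at h
      exact absurd (of_mul_inj h).1 (by simp)
    | succ m =>
      rw [pow_succ', pow_succ', mul_assoc, mul_assoc] at h
      obtain ⟨h1, h2⟩ := ih (of_mul_inj h).2
      exact ⟨by rw [h1], h2⟩

theorem markWord_of_mul (x : X) (n : ℕ) (z : FreeMonoid (X × ℕ)) :
    markWord (FreeMonoid.of (x, n) * z) =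
      FreeMonoid.of none ^ n * (FreeMonoid.of (some x) * markWord z) := by
  rw [map_mul, markWord_of, mul_assoc]

theorem pow_mul_ne_one (n : ℕ) (x : X) (a : FreeMonoid (Option X)) :
    FreeMonoid.of none ^ n * (FreeMonoid.of (some x) * a) ≠ 1 := by
  cases n with
  | zero => exact of_mul_ne_one _ _
  | succ n =>
    rw [pow_succ', mul_assoc]
    exact of_mul_ne_one _ _

/-- Each letter of `X` ends the image of one differential letter, and the number of marks just
before it gives back the level. -/
theorem markWord_injective : Function.Injective (markWord (X := X)) := by
  intro z z' h
  induction z using FreeMonoid.inductionOn' generalizing z' with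
  | one =>
    cases z' using FreeMonoid.casesOn with
    | one => rfl
    | of_mul p z' =>
      rw [map_one, markWord_of_mul] at h
      exact absurd h.symm (pow_mul_ne_one _ _ _)
  | of_mul p z ih =>
    cases z' using FreeMonoid.casesOn with
    | one =>
      rw [map_one, markWord_of_mul] at h
      exact absurd h (pow_mul_ne_one _ _ _)
    | of_mul p' z' =>
      rw [markWord_of_mul, markWord_of_mul] at h
      obtain ⟨h1, h2, h3⟩ := mark_pow_inj h
      rw [ih h3, Prod.ext h2 h1]

theorem markWord_eq_map_mul {t : FreeMonoid X} {b : FreeMonoid (Option X)}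
    {z : FreeMonoid (X × ℕ)} (h : markWord z = FreeMonoid.map some t * b) :
    ∃ β, z = FreeMonoid.map (fun x => (x, 0)) t * β := by
  induction t using FreeMonoid.inductionOn' generalizing z with
  | one => exact ⟨z, by simp⟩
  | of_mul y t ih =>
    rw [map_mul, FreeMonoid.map_of, mul_assoc] at h
    cases z using FreeMonoid.casesOn with
    | one => exact absurd h.symm (of_mul_ne_one _ _)
    | of_mul p z =>
      obtain ⟨x, n⟩ := p
      rw [markWord_of_mul] at h
      obtain ⟨rfl, rfl, h3⟩ := mark_pow_inj (m := 0) (by simpa using h)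
      obtain ⟨β, rfl⟩ := ih h3
      exact ⟨β, by rw [map_mul, FreeMonoid.map_of, mul_assoc]⟩

/-- A nonempty word without marks cannot start inside the block of marks: it starts at `x` or later.
-/
theorem mark_factor {n : ℕ} {x : X} {w a b : FreeMonoid (Option X)} {t : FreeMonoid X}
    (ht : t ≠ 1) (h : FreeMonoid.of none ^ n * (FreeMonoid.of (some x) * w) =
      a * FreeMonoid.map some t * b) :
    (∃ a', w = a' * FreeMonoid.map some t * b) ∨
      ∃ t', t = FreeMonoid.of x * t' ∧ w = FreeMonoid.map some t' * b := by
  induction n generalizing a with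
  | zero =>
    rw [pow_zero, one_mul] at h
    cases a using FreeMonoid.casesOn with
    | one =>
      cases t using FreeMonoid.casesOn with
      | one => exact absurd rfl ht
      | of_mul y t =>
        rw [one_mul, map_mul, FreeMonoid.map_of, mul_assoc] at h
        obtain ⟨h1, h2⟩ := of_mul_inj h
        exact Or.inr ⟨t, by rw [Option.some.inj h1], h2⟩
    | of_mul o a =>
      rw [mul_assoc, mul_assoc] at h
      exact Or.inl ⟨a, by rw [(of_mul_inj h).2, mul_assoc]⟩
  | succ n ih =>
    rw [pow_succ', mul_assoc] at h
    cases a using FreeMonoid.casesOn with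
    | one =>
      cases t using FreeMonoid.casesOn with
      | one => exact absurd rfl ht
      | of_mul y t =>
        rw [one_mul, map_mul, FreeMonoid.map_of, mul_assoc] at h
        exact absurd (of_mul_inj h).1 (by simp)
    | of_mul o a =>
      rw [mul_assoc, mul_assoc] at h
      exact ih (a := a) (by rw [(of_mul_inj h).2, mul_assoc])

theorem diffPow_of_ne {lam : k} (hlam : lam ≠ 0) (n : ℕ) (w : FreeMonoid X) :
    diffPow lam n w = FreeMonoid.map (fun x => (x, n)) w := by
  simp [diffPow, hlam]

theorem diffPow_zero_of_mul (n : ℕ) (x : X) (w : FreeMonoid X) :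
    diffPow (0 : k) n (FreeMonoid.of x * w) =
      FreeMonoid.of (x, n) * FreeMonoid.map (fun y => (y, 0)) w := by
  simp [diffPow]

theorem diffPow_one (lam : k) (n : ℕ) : diffPow lam n (1 : FreeMonoid X) = 1 := by
  simp [diffPow]

/-- The letters of an occurrence of `t` are not separated by marks, so all of them except the first
come from level `0`, while the first may be preceded by any number `n` of marks. This is the factor
`t^[n]` of weight zero. -/
theorem markWord_factor {t : FreeMonoid X} (ht : t ≠ 1) {a b : FreeMonoid (Option X)}
    {z : FreeMonoid (X × ℕ)} (h : markWord z = a * FreeMonoid.map some t * b) :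
    ∃ n α β, z = α * diffPow (0 : k) n t * β := by
  induction z using FreeMonoid.inductionOn' generalizing a with
  | one =>
    rw [map_one] at h
    cases t using FreeMonoid.casesOn with
    | one => exact absurd rfl ht
    | of_mul y t =>
      have := congrArg FreeMonoid.length h
      simp only [map_mul, FreeMonoid.length_mul, FreeMonoid.map_of, FreeMonoid.length_of,
        FreeMonoid.length_one] at this
      omega
  | of_mul p z ih =>
    obtain ⟨x, n⟩ := p
    rw [markWord_of_mul] at h
    rcases mark_factor ht h with ⟨a', h'⟩ | ⟨t', rfl, h'⟩
    · obtain ⟨m, α, β, rfl⟩ := ih h'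
      exact ⟨m, FreeMonoid.of (x, n) * α, β, by simp only [mul_assoc]⟩
    · obtain ⟨β, rfl⟩ := markWord_eq_map_mul h'
      exact ⟨n, 1, β, by rw [diffPow_zero_of_mul, one_mul, mul_assoc]⟩

/-! ### Two models of differential algebras -/

/-- The quotient of `k⟨Z⟩` by the two-sided ideal generated by `S`. -/
abbrev presented (S : Set (NCPoly k Z)) : Type u :=
  NCPoly k Z ⧸ (TwoSidedIdeal.span S).asIdeal

/-- The quotient map to a presented algebra. -/
abbrev presentedMk (S : Set (NCPoly k Z)) : NCPoly k Z →ₐ[k] presented S :=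
  Ideal.Quotient.mkₐ k _

theorem presentedMk_eq_zero {S : Set (NCPoly k Z)} {f : NCPoly k Z} :
    presentedMk S f = 0 ↔ f ∈ TwoSidedIdeal.span S := by
  rw [Ideal.Quotient.mkₐ_eq_mk, Ideal.Quotient.eq_zero_iff_mem, TwoSidedIdeal.mem_asIdeal]

theorem map_eq_zero_of_mem_span {R : Type*} [Ring R] [Algebra k R] {S : Set (NCPoly k Z)}
    (F : NCPoly k Z →ₐ[k] R) (hF : ∀ s ∈ S, F s = 0) {f : NCPoly k Z}
    (hf : f ∈ TwoSidedIdeal.span S) : F f = 0 := by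
  have : TwoSidedIdeal.span S ≤ TwoSidedIdeal.ker F :=
    TwoSidedIdeal.span_le.2 fun s hs => (TwoSidedIdeal.mem_ker F).2 (hF s hs)
  exact (TwoSidedIdeal.mem_ker F).1 (this hf)

/-- An algebra endomorphism `σ` gives the differential operator `lam⁻¹(σ - 1)` of weight `lam`. -/
def endDiff {R : Type*} [Ring R] [Algebra k R] (lam : k) (σ : R →ₐ[k] R) : R →ₗ[k] R :=
  lam⁻¹ • (σ.toLinearMap - LinearMap.id)

theorem endDiff_apply {R : Type*} [Ring R] [Algebra k R] (lam : k) (σ : R →ₐ[k] R) (x : R) :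
    endDiff lam σ x = lam⁻¹ • (σ x - x) := rfl

theorem endDiff_isDiffOp {R : Type u} [Ring R] [Algebra k R] {lam : k} (hlam : lam ≠ 0)
    (σ : R →ₐ[k] R) : IsDiffOp lam (endDiff lam σ) where
  leibniz x y := by
    simp only [endDiff_apply, map_mul, smul_mul_assoc, mul_smul_comm, smul_smul]
    rw [← mul_assoc, mul_inv_cancel₀ hlam, one_mul, ← smul_add, ← smul_add]
    congr 1
    noncomm_ring
  map_one := by rw [endDiff_apply, map_one, sub_self, smul_zero]

/-- The commutator with `y` as an operator. -/
def innerDiff (k : Type u) [Field k] {R : Type*} [Ring R] [Algebra k R] (y : R) : R →ₗ[k] R :=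
  LinearMap.mulLeft k y - LinearMap.mulRight k y

theorem innerDiff_apply {R : Type*} [Ring R] [Algebra k R] (y x : R) :
    innerDiff k y x = y * x - x * y := rfl

theorem innerDiff_isDiffOp {R : Type u} [Ring R] [Algebra k R] (y : R) :
    IsDiffOp (0 : k) (innerDiff k y) where
  leibniz x z := by
    simp only [innerDiff_apply, zero_smul, add_zero]
    noncomm_ring
  map_one := by rw [innerDiff_apply, mul_one, one_mul, sub_self]

/-- The shift of levels. -/
def shift (k X : Type u) [Field k] : NCPoly k (X × ℕ) →ₐ[k] NCPoly k (X × ℕ) :=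
  letterHom k fun p => (p.1, p.2 + 1)

theorem shift_letterHom (n : ℕ) (f : NCPoly k X) :
    shift k X (letterHom k (fun x => (x, n)) f) = letterHom k (fun x => (x, n + 1)) f := by
  have : (shift k X).toLinearMap ∘ₗ (letterHom k fun x : X => (x, n)).toLinearMap =
      (letterHom k fun x : X => (x, n + 1)).toLinearMap := by
    refine linearMap_ext_words fun w => ?_
    simp only [LinearMap.comp_apply, AlgHom.toLinearMap_apply, shift, letterHom_ncWord]
    congr 1
    exact List.map_map
  exact LinearMap.congr_fun this f

/-- Expanding `lam⁻ⁿ(σ - 1)ⁿ` on `x^{(0)}` gives `lam⁻ⁿ x^{(n)}` plus multiples of letters `x^{(j)}`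
with `j < n`; these are smaller because their part of level `n` is empty. -/
theorem endDiff_shift_iterate (ord : WordOrder X) (lam : k) (x : X) (n : ℕ) :
    LeadsTo (levelLT ord) ((endDiff lam (shift k X))^[n] (ncWord k (FreeMonoid.of (x, 0))))
      (FreeMonoid.of (x, n)) (lam⁻¹ ^ n) := by
  suffices H : (endDiff lam (shift k X))^[n] (ncWord k (FreeMonoid.of (x, 0))) -
      lam⁻¹ ^ n • ncWord k (FreeMonoid.of (x, n)) ∈
        wordSpan k {w | ∃ j < n, FreeMonoid.of (x, j) = w} by
    refine wordSpan_mono ?_ H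
    rintro _ ⟨j, hj, rfl⟩
    refine ⟨n, ?_, fun m hm => ?_⟩
    · simp only [levelPart_of, if_true, if_neg hj.ne]
      exact ord.one_lt _ (FreeMonoid.of_ne_one x)
    · simp only [levelPart_of, if_neg hm.ne, if_neg (hj.trans hm).ne]
  have hd : ∀ j, endDiff lam (shift k X) (ncWord k (FreeMonoid.of (x, j))) =
      lam⁻¹ • (ncWord k (FreeMonoid.of (x, j + 1)) - ncWord k (FreeMonoid.of (x, j))) := by
    intro j
    rw [endDiff_apply, shift, letterHom_ncWord, FreeMonoid.map_of]
  induction n with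
  | zero =>
    rw [Function.iterate_zero_apply, pow_zero, one_smul, sub_self]
    exact zero_mem _
  | succ n ih =>
    rw [Function.iterate_succ_apply']
    have key : endDiff lam (shift k X)
          ((endDiff lam (shift k X))^[n] (ncWord k (FreeMonoid.of (x, 0)))) -
          lam⁻¹ ^ (n + 1) • ncWord k (FreeMonoid.of (x, n + 1)) =
        endDiff lam (shift k X)
          ((endDiff lam (shift k X))^[n] (ncWord k (FreeMonoid.of (x, 0))) -
            lam⁻¹ ^ n • ncWord k (FreeMonoid.of (x, n))) -
          lam⁻¹ ^ (n + 1) • ncWord k (FreeMonoid.of (x, n)) := by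
      rw [map_sub, map_smul, hd, smul_smul, ← pow_succ, smul_sub]
      abel
    have hmem : ∀ j < n + 1, ncWord k (FreeMonoid.of (x, j)) ∈
        wordSpan k {w | ∃ j < n + 1, FreeMonoid.of (x, j) = w} := fun j hj =>
      ncWord_mem_wordSpan ⟨j, hj, rfl⟩
    rw [key]
    refine sub_mem (map_mem_of_wordSpan _ ?_ ih) (Submodule.smul_mem _ _ (hmem n n.lt_succ_self))
    rintro _ ⟨j, hj, rfl⟩
    rw [hd]
    exact Submodule.smul_mem _ _ (sub_mem (hmem _ (by omega)) (hmem _ (by omega)))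

theorem markDeg_pow (n : ℕ) (w : FreeMonoid (Option X)) :
    markDeg (FreeMonoid.of none ^ n * w) = n + markDeg w := by
  induction n with
  | zero => simp
  | succ n ih => rw [pow_succ', mul_assoc, markDeg_none, ih]; omega

theorem blockPart_pow (n : ℕ) (w : FreeMonoid (Option X)) (m : ℕ) :
    blockPart (FreeMonoid.of none ^ n * w) m = if n ≤ m then blockPart w (m - n) else 1 := by
  induction n generalizing m with
  | zero => simp
  | succ n ih =>
    rw [pow_succ', mul_assoc]
    cases m with
    | zero => rw [blockPart_none_zero, if_neg (by omega)]
    | succ m =>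
      rw [blockPart_none_succ, ih, Nat.add_sub_add_right]
      simp only [Nat.add_le_add_iff_right]

theorem blockLT_pow {ord : WordOrder X} (n : ℕ) {w w' : FreeMonoid (Option X)}
    (h : blockLT ord w w') :
    blockLT ord (FreeMonoid.of none ^ n * w) (FreeMonoid.of none ^ n * w') :=
  (blockLT_rewriteOrder ord).mul_left _ h

/-- Moving a mark to the right of a letter makes the word smaller. -/
theorem blockLT_mark_swap (ord : WordOrder X) (x : X) :
    blockLT ord (FreeMonoid.of (some x) * FreeMonoid.of none)
      (FreeMonoid.of none * FreeMonoid.of (some x)) := by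
  have h1 : blockPart (FreeMonoid.of (some x) * FreeMonoid.of none) =
      fun n => if n = 0 then FreeMonoid.of x else 1 := by
    funext n
    cases n with
    | zero =>
      rw [blockPart_some_zero]
      simpa using congrArg (FreeMonoid.of x * ·) (blockPart_none_zero 1)
    | succ n =>
      rw [blockPart_some_succ, ← mul_one (FreeMonoid.of none), blockPart_none_succ, blockPart_one,
        if_neg n.succ_ne_zero]
  have h2 : ∀ n, blockPart (FreeMonoid.of none * FreeMonoid.of (some x)) n =
      if n = 1 then FreeMonoid.of x else 1 := by
    intro n
    cases n with
    | zero => rw [blockPart_none_zero, if_neg (by omega)]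
    | succ n =>
      rw [blockPart_none_succ, ← FreeMonoid.map_of some x, blockPart_map_some]
      simp
  refine ⟨by rw [markDeg_mul, markDeg_mul, add_comm], 1, ?_, fun m hm => ?_⟩
  · rw [h1, h2, if_pos rfl]
    exact ord.one_lt _ (FreeMonoid.of_ne_one x)
  · rw [h1, h2, if_neg hm.ne']
    exact if_neg (by omega)

theorem blockLT_mark_swap_pow (ord : WordOrder X) (x : X) (n : ℕ) :
    blockLT ord (FreeMonoid.of none ^ n * FreeMonoid.of (some x) * FreeMonoid.of none)
      (FreeMonoid.of none ^ (n + 1) * FreeMonoid.of (some x)) := by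
  rw [mul_assoc, pow_succ, mul_assoc]
  exact blockLT_pow n (blockLT_mark_swap ord x)

/-- The iterated commutator is an alternating binomial sum of the words `y^{n-j} x y^j`, and moving
marks to the right of `x` makes a word smaller, so `yⁿx` leads with coefficient `1`. -/
theorem innerDiff_iterate (ord : WordOrder X) (x : X) (n : ℕ) :
    LeadsTo (blockLT ord) ((innerDiff k (ncWord k (FreeMonoid.of (none : Option X))))^[n]
      (ncWord k (FreeMonoid.of (some x)))) (FreeMonoid.of none ^ n * FreeMonoid.of (some x)) 1 := by
  have hlt := blockLT_rewriteOrder ord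
  induction n with
  | zero =>
    rw [Function.iterate_zero_apply, pow_zero, one_mul, LeadsTo, one_smul, sub_self]
    exact zero_mem _
  | succ n ih =>
    rw [Function.iterate_succ_apply', innerDiff_apply]
    rw [LeadsTo, one_smul] at ih ⊢
    have hY : ∀ v : FreeMonoid (Option X), ncWord k v ∈ wordSpan k {v} :=
      fun v => ncWord_mem_wordSpan rfl
    generalize (innerDiff k (ncWord k (FreeMonoid.of (none : Option X))))^[n]
      (ncWord k (FreeMonoid.of (some x))) = f at ih ⊢
    have key : ncWord k (FreeMonoid.of none) * f - f * ncWord k (FreeMonoid.of none) -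
        ncWord k (FreeMonoid.of none ^ (n + 1) * FreeMonoid.of (some x)) =
        ncWord k (FreeMonoid.of none) *
            (f - ncWord k (FreeMonoid.of none ^ n * FreeMonoid.of (some x))) -
          (f - ncWord k (FreeMonoid.of none ^ n * FreeMonoid.of (some x))) *
            ncWord k (FreeMonoid.of none) -
          ncWord k (FreeMonoid.of none ^ n * FreeMonoid.of (some x) * FreeMonoid.of none) := by
      simp only [mul_sub, sub_mul, ncWord_mul, pow_succ', mul_assoc]
      abel
    rw [key]
    refine sub_mem (sub_mem (mul_mem_wordSpan ?_ (hY _) ih) (mul_mem_wordSpan ?_ ih (hY _)))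
      (ncWord_mem_wordSpan (blockLT_mark_swap_pow ord x n))
    · rintro u rfl v hv
      change blockLT ord _ _
      rw [pow_succ', mul_assoc]
      exact hlt.mul_left _ hv
    · rintro u hu v rfl
      exact hlt.trans (hlt.mul_right _ hu) (blockLT_mark_swap_pow ord x n)

/-! ### Linear independence of the avoiding words -/

theorem linearIndependent_avoidingWords {A D : Type u} [Ring A] [Algebra k A] [Ring D]
    [Algebra k D] {lam : k} {d : D →ₗ[k] D} {i : A →ₐ[k] D} (hD : IsFreeDiffAlgebra lam d i)
    {π : NCPoly k X →ₐ[k] A} (hπ : Function.Surjective π) {ord : WordOrder X}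
    {S : Set (NCPoly k X)} (hS : IsGSBasisOf ord S (TwoSidedIdeal.ker π))
    (h1 : ∀ s ∈ S, ¬ IsLeadingWord ord.lt s 1) :
    LinearIndependent k fun z : avoidingWords lam ord.lt S =>
      diffWordEval d (fun x : X => i (π (ncWord k (FreeMonoid.of x)))) z.1 := by
  have hker : ∀ f, π f = 0 → f ∈ TwoSidedIdeal.span S := fun f hf => by
    rw [hS.2]
    exact (TwoSidedIdeal.mem_ker π).2 hf
  have hlead : ∀ {J : Type} {Z : Type u} (ι : J → X → Z) (lt : FreeMonoid Z → FreeMonoid Z → Prop)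
      (_ : ∀ j, Function.Injective (ι j))
      (_ : ∀ j u v, ord.lt u v → lt (FreeMonoid.map (ι j) u) (FreeMonoid.map (ι j) v)),
      ∀ s ∈ copies ι S, ∃ t, IsLeadingWord lt s t := by
    rintro J Z ι lt hinj hmono _ ⟨j, s, hs, rfl⟩
    obtain ⟨t, ht, -⟩ := hS.1.monic s hs
    exact ⟨_, isLeadingWord_letterHom (hinj j) (hmono j) ht⟩
  have hcopy : ∀ {J : Type} {Z : Type u} (ι : J → X → Z) (j : J) (f : NCPoly k X), π f = 0 →
      presentedMk (copies ι S) (letterHom k (ι j) f) = 0 := fun ι j f hf =>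
    map_eq_zero_of_mem_span ((presentedMk (copies ι S)).comp (letterHom k (ι j)))
      (fun s hs => presentedMk_eq_zero.2
        (TwoSidedIdeal.subset_span (letterHom_mem_copies ι j hs))) (hker f hf)
  by_cases hlam : lam = 0
  · subst hlam
    -- A single copy of `S` in the letters `some x`, with `none` left free: the quotient is the free
    -- product of `A` with `k[y]`.
    let ι : Unit → X → Option X := fun _ => some
    have hinj : ∀ j, Function.Injective (ι j) := fun _ => Option.some_injective X
    have hmono : ∀ j u v, ord.lt u v →
      blockLT ord (FreeMonoid.map (ι j) u) (FreeMonoid.map (ι j) v) :=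
        fun _ _ _ h => blockLT_map_some h
    have hlt := blockLT_rewriteOrder ord
    obtain ⟨monic, hconf⟩ := confluent_copies hlt hinj (fun _ _ _ _ _ => rfl) hmono hS.1 h1
    let q := presentedMk (copies ι S)
    refine linearIndependent_diffWordEval hD hπ
      (innerDiff_isDiffOp (q (ncWord k (FreeMonoid.of none)))) hlt
      (hlead ι _ hinj hmono) monic hconf q (fun f => presentedMk_eq_zero.1)
      (innerDiff k (ncWord k (FreeMonoid.of none)))
      (fun f => by rw [innerDiff_apply, innerDiff_apply, map_sub, map_mul, map_mul]) some
      (hcopy ι ()) markWord markWord_injective (fun _ => 1) (fun _ => one_ne_zero)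
      (fun p => by
        rw [markWord_of]
        exact innerDiff_iterate ord p.1 p.2) _ ?_
    rintro z hz _ ⟨j, s, hs, rfl⟩ p hp a b hab
    obtain ⟨t, ht, rfl⟩ := leadingWord_copy (j := j) hlt hinj hmono hS.1 hs hp
    have ht1 : t ≠ 1 := by
      rintro rfl
      exact h1 s hs ht
    obtain ⟨n, α, β, h⟩ := markWord_factor (k := k) ht1 hab
    exact hz s hs t ht n α β h
  -- One copy of `S` for each level: the quotient is the free product of countably many copies of
  -- `A`.
  · let ι : ℕ → X → X × ℕ := fun n x => (x, n)
    have hinj : ∀ j, Function.Injective (ι j) := fun _ _ _ h => (Prod.ext_iff.1 h).1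
    have hmono : ∀ j u v, ord.lt u v →
      levelLT ord (FreeMonoid.map (ι j) u) (FreeMonoid.map (ι j) v) :=
        fun n _ _ h => levelLT_map n h
    have hlt := levelLT_rewriteOrder ord
    obtain ⟨monic, hconf⟩ := confluent_copies hlt hinj (fun _ _ _ _ h => (Prod.ext_iff.1 h).2)
      hmono hS.1 h1
    let q := presentedMk (copies ι S)
    -- The shift carries the relations of level `n` to those of level `n + 1`, so it descends to the
    -- quotient.
    have hσ : ∀ f ∈ (TwoSidedIdeal.span (copies ι S)).asIdeal, (q.comp (shift k X)) f = 0 := by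
      intro f hf
      refine map_eq_zero_of_mem_span (q.comp (shift k X)) ?_ (TwoSidedIdeal.mem_asIdeal.1 hf)
      rintro _ ⟨n, s, hs, rfl⟩
      rw [AlgHom.comp_apply, shift_letterHom]
      exact presentedMk_eq_zero.2
        (TwoSidedIdeal.subset_span (letterHom_mem_copies ι (n + 1) hs))
    let σ : presented (copies ι S) →ₐ[k] presented (copies ι S) :=
      Ideal.Quotient.liftₐ _ (q.comp (shift k X)) hσ
    refine linearIndependent_diffWordEval hD hπ (endDiff_isDiffOp hlam σ) hlt
      (hlead ι _ hinj hmono) monic hconf q (fun f => presentedMk_eq_zero.1)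
      (endDiff lam (shift k X)) (fun f => ?_) (ι 0)
      (hcopy ι 0) (MonoidHom.id _) Function.injective_id (fun p => lam⁻¹ ^ p.2)
      (fun p => pow_ne_zero _ (inv_ne_zero hlam))
      (fun p => endDiff_shift_iterate ord lam p.1 p.2) _ ?_
    · rw [endDiff_apply, endDiff_apply, map_smul, map_sub]
      rfl
    rintro z hz _ ⟨n, s, hs, rfl⟩ p hp a b hab
    obtain ⟨t, ht, rfl⟩ := leadingWord_copy (j := n) hlt hinj hmono hS.1 hs hp
    exact hz s hs t ht n a b (by rw [diffPow_of_ne hlam]; exact hab)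

/-! ### Leading words of iterated differentials -/

theorem dX_ncWord (lam : k) (w : FreeMonoid (X × ℕ)) :
    dX lam (ncWord k w) = dWord lam (FreeMonoid.toList w) :=
  wordExtend_ncWord (fun w : FreeMonoid (X × ℕ) => dWord lam (FreeMonoid.toList w)) w

/-- The sum of the levels of the letters of a differential word. -/
def levelSum (v : FreeMonoid (X × ℕ)) : ℕ :=
  ((FreeMonoid.toList v).map Prod.snd).sum

/-- The differential words over the word `w` that may occur in the `n`-th differential of `w`. -/
def levelWords (lam : k) (n : ℕ) (w : FreeMonoid X) : Set (FreeMonoid (X × ℕ)) :=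
  {v | FreeMonoid.map Prod.fst v = w ∧ (∀ p ∈ FreeMonoid.toList v, p.2 ≤ n) ∧
    (lam = 0 → levelSum v = n)}

/-- The product rule alters levels only. Each term raises each letter by at most one level; in
weight zero exactly one letter is raised, so the sum of the levels grows by one. -/
theorem dWord_mem_wordSpan (lam : k) (l : List (X × ℕ)) :
    dWord lam l ∈ wordSpan k {v | (FreeMonoid.toList v).map Prod.fst = l.map Prod.fst ∧
      (∀ n, (∀ p ∈ l, p.2 ≤ n) → ∀ p ∈ FreeMonoid.toList v, p.2 ≤ n + 1) ∧
      (lam = 0 → levelSum v = (l.map Prod.snd).sum + 1)} := by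
  induction l with
  | nil => exact zero_mem _
  | cons p l ih =>
    rw [dWord]
    refine add_mem (add_mem ?_ ?_) ?_
    · rw [← ncWord_mul]
      refine ncWord_mem_wordSpan ⟨by simp, ?_, fun _ => ?_⟩
      · intro n hn q hq
        rw [FreeMonoid.toList_of_mul, List.mem_cons] at hq
        rcases hq with rfl | hq
        · exact Nat.succ_le_succ (hn p List.mem_cons_self)
        · exact (hn q (List.mem_cons_of_mem _ hq)).trans (Nat.le_succ n)
      · simp only [levelSum, FreeMonoid.toList_of_mul, FreeMonoid.toList_ofList, List.map_cons,
          List.sum_cons]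
        omega
    · refine mul_mem_wordSpan ?_ (ncWord_mem_wordSpan (Set.mem_singleton _)) ih
      rintro _ rfl v ⟨h1, h2, h3⟩
      refine ⟨by simp [h1], ?_, fun h0 => ?_⟩
      · intro n hn q hq
        rw [FreeMonoid.toList_of_mul, List.mem_cons] at hq
        rcases hq with rfl | hq
        · exact (hn q List.mem_cons_self).trans (Nat.le_succ n)
        · exact h2 n (fun p hp => hn p (List.mem_cons_of_mem _ hp)) q hq
      · have := h3 h0
        simp only [levelSum, FreeMonoid.toList_of_mul, List.map_cons, List.sum_cons] at this ⊢
        omega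
    · by_cases hlam : lam = 0
      · rw [hlam, zero_smul]
        exact zero_mem _
      · refine Submodule.smul_mem _ _
          (mul_mem_wordSpan ?_ (ncWord_mem_wordSpan (Set.mem_singleton _)) ih)
        rintro _ rfl v ⟨h1, h2, h3⟩
        refine ⟨by simp [h1], ?_, fun h0 => absurd h0 hlam⟩
        intro n hn q hq
        rw [FreeMonoid.toList_of_mul, List.mem_cons] at hq
        rcases hq with rfl | hq
        · exact Nat.succ_le_succ (hn p List.mem_cons_self)
        · exact h2 n (fun p hp => hn p (List.mem_cons_of_mem _ hp)) q hq

theorem dX_mem_levelWords (lam : k) (n : ℕ) (w : FreeMonoid X) {f : NCPoly k (X × ℕ)}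
    (hf : f ∈ wordSpan k (levelWords lam n w)) :
    dX lam f ∈ wordSpan k (levelWords lam (n + 1) w) := by
  refine map_mem_of_wordSpan _ ?_ hf
  rintro v ⟨h1, h2, h3⟩
  rw [dX_ncWord]
  refine wordSpan_mono ?_ (dWord_mem_wordSpan lam _)
  rintro u ⟨hu1, hu2, hu3⟩
  exact ⟨hu1.trans h1, hu2 n h2, fun h0 => (hu3 h0).trans (congrArg (· + 1) (h3 h0))⟩

theorem map_mem_levelWords_zero (lam : k) (w : FreeMonoid X) :
    FreeMonoid.map (fun x => (x, 0)) w ∈ levelWords lam 0 w := by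
  refine ⟨?_, ?_, fun _ => ?_⟩
  · exact (List.map_map).trans (List.map_id _)
  · intro p hp
    obtain ⟨x, -, rfl⟩ := List.mem_map.1 hp
    exact le_rfl
  · simp [levelSum, Function.comp_def]

theorem dX_iterate_mem (lam : k) (n : ℕ) (w : FreeMonoid X) :
    (dX lam)^[n] (hatEmbedding (ncWord k w)) ∈ wordSpan k (levelWords lam n w) := by
  induction n with
  | zero =>
    rw [Function.iterate_zero_apply]
    change letterHom k (fun x => (x, 0)) (ncWord k w) ∈ _
    rw [letterHom_ncWord]
    exact ncWord_mem_wordSpan (map_mem_levelWords_zero lam w)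
  | succ n ih =>
    rw [Function.iterate_succ_apply']
    exact dX_mem_levelWords lam n w ih

open Classical in

theorem coeff_of_mul (q y : X) (f : NCPoly k X) (u : FreeMonoid X) :
    (ncWord k (FreeMonoid.of q) * f).coeff (FreeMonoid.of y * u) =
      if q = y then f.coeff u else 0 := by
  have key : Finsupp.lapply (FreeMonoid.of y * u) ∘ₗ
        (MonoidAlgebra.coeffLinearEquiv k).toLinearMap ∘ₗ
          (LinearMap.mulLeft k (ncWord k (FreeMonoid.of q))) =
      (if q = y then (1 : k) else 0) •
        (Finsupp.lapply u ∘ₗ (MonoidAlgebra.coeffLinearEquiv k).toLinearMap) := by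
    refine linearMap_ext_words fun v => ?_
    simp only [LinearMap.comp_apply, LinearMap.smul_apply,
      LinearMap.mulLeft_apply, ← ncWord_mul, Finsupp.lapply_apply]
    change (ncWord k (FreeMonoid.of q * v)).coeff (FreeMonoid.of y * u) =
      (if q = y then (1 : k) else 0) • (ncWord k v).coeff u
    by_cases hv : v = u
    · subst hv
      by_cases hq : q = y
      · subst hq
        rw [coeff_ncWord_self, coeff_ncWord_self, if_pos rfl, one_smul]
      · rw [coeff_ncWord_ne (fun h => hq (of_mul_inj h).1), if_neg hq, zero_smul]
    · rw [coeff_ncWord_ne (fun h => hv (of_mul_inj h).2), coeff_ncWord_ne hv, smul_zero]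
  refine (LinearMap.congr_fun key f).trans ?_
  change (if q = y then (1 : k) else 0) • f.coeff u = _
  rw [ite_smul, one_smul, zero_smul]

theorem map_of_mul {Y : Type*} (g : X → Y) (x : X) (w : FreeMonoid X) :
    FreeMonoid.map g (FreeMonoid.of x * w) = FreeMonoid.of (g x) * FreeMonoid.map g w := rfl

theorem coeff_dWord_one (lam : k) (l : List (X × ℕ)) : (dWord lam l).coeff 1 = 0 := by
  by_contra h
  obtain ⟨h1, -, -⟩ := mem_wordSpan_iff.1 (dWord_mem_wordSpan lam l) 1 h
  have : l = [] := List.map_eq_nil_iff.1 h1.symm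
  subst this
  exact h rfl

/-- Starting from levels at most `n`, all letters reach level `n + 1` only if all have level `n` and
all are differentiated. That term of the product rule carries one factor `lam` for each letter
beyond the first. -/
theorem coeff_dWord_of_ne {lam : k} (n : ℕ) (l : List (X × ℕ)) (hl : ∀ p ∈ l, p.2 ≤ n)
    (w : FreeMonoid X) (hw : w ≠ 1) :
    (dWord lam l).coeff (FreeMonoid.map (fun x => (x, n + 1)) w) =
      lam ^ (w.length - 1) *
        (ncWord k (FreeMonoid.ofList l)).coeff (FreeMonoid.map (fun x => (x, n)) w) := by
  induction l generalizing w with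
  | nil =>
    rw [coeff_ncWord_ne, mul_zero]
    · rfl
    · exact fun h => hw (List.map_eq_nil_iff.1 h.symm)
  | cons p l ih =>
    cases w using FreeMonoid.casesOn with
    | one => exact absurd rfl hw
    | of_mul x w =>
      have hl' : ∀ p ∈ l, p.2 ≤ n := fun q hq => hl q (List.mem_cons_of_mem _ hq)
      have hp : p.2 ≤ n := hl p List.mem_cons_self
      rw [dWord, FreeMonoid.ofList_cons, ncWord_mul, map_of_mul, map_of_mul, MonoidAlgebra.coeff_add, MonoidAlgebra.coeff_add, Finsupp.add_apply,
        Finsupp.add_apply, MonoidAlgebra.coeff_smul_apply, coeff_of_mul, coeff_of_mul,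
        coeff_of_mul, coeff_of_mul, if_neg (c := p = (x, n + 1)) (by rintro rfl; simp at hp),
        add_zero, smul_eq_mul]
      have hiff : ((p.1, p.2 + 1) = (x, n + 1)) = (p = (x, n)) := by
        simp [Prod.ext_iff]
      rw [hiff]
      by_cases hpx : p = (x, n)
      · simp only [if_pos hpx]
        by_cases hw1 : w = 1
        · subst hw1
          have hm : ∀ m : ℕ, FreeMonoid.map (fun x : X => (x, m)) 1 = 1 := fun _ => rfl
          rw [hm, hm, coeff_dWord_one, mul_zero, add_zero, mul_one, FreeMonoid.length_of,
            Nat.sub_self, pow_zero, one_mul]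
        -- The term leaving the tail `l` undifferentiated contributes nothing, as `l` has no letter
        -- of level `n + 1` and `w` is nonempty.
        · rw [ih hl' w hw1, coeff_ncWord_ne, zero_add, ← mul_assoc, ← pow_succ',
            FreeMonoid.length_mul, FreeMonoid.length_of]
          · have : w.length ≠ 0 := fun h => hw1 (FreeMonoid.length_eq_zero.1 h)
            congr 2
            omega
          · rintro h
            cases w using FreeMonoid.casesOn with
            | one => exact hw1 rfl
            | of_mul y w =>
              have h2 : (y, n + 1) ∈ l := by
                have : l = (y, n + 1) ::
                    FreeMonoid.toList (FreeMonoid.map (fun x => (x, n + 1)) w) := h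
                rw [this]
                exact List.mem_cons_self
              have := hl' _ h2
              simp at this
      · simp only [if_neg hpx, mul_zero, add_zero]

/-- Terms differentiating a letter after the first have a tail of positive level sum, so only the
term differentiating the first letter counts. -/
theorem coeff_dWord_zero (n : ℕ) (l : List (X × ℕ)) (x : X) (w : FreeMonoid X) :
    (dWord (0 : k) l).coeff (FreeMonoid.of (x, n + 1) * FreeMonoid.map (fun y => (y, 0)) w) =
      (ncWord k (FreeMonoid.ofList l)).coeff
        (FreeMonoid.of (x, n) * FreeMonoid.map (fun y => (y, 0)) w) := by
  cases l with
  | nil =>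
    rw [coeff_ncWord_ne]
    · rfl
    · exact fun h => of_mul_ne_one _ _ h.symm
  | cons p l =>
    have h0 : (dWord (0 : k) l).coeff (FreeMonoid.map (fun y => (y, 0)) w) = 0 := by
      by_contra h
      obtain ⟨-, -, h3⟩ := mem_wordSpan_iff.1 (dWord_mem_wordSpan (0 : k) l) _ h
      have := h3 rfl
      simp [levelSum, Function.comp_def] at this
    have hiff : ((p.1, p.2 + 1) = (x, n + 1)) = (p = (x, n)) := by
      simp [Prod.ext_iff]
    rw [dWord, FreeMonoid.ofList_cons, zero_smul, add_zero, MonoidAlgebra.coeff_add,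
      Finsupp.add_apply, ncWord_mul, coeff_of_mul, coeff_of_mul, coeff_of_mul, h0, ite_self,
      add_zero, hiff]

/-- The constant is `1` in weight zero and `lam ^ (w.length - 1)` otherwise. It does not depend on
`n`, and being nonzero it keeps `w^[n]` present in every iterate. -/
theorem exists_coeff_dX (lam : k) {w : FreeMonoid X} (hw : w ≠ 1) :
    ∃ κ : k, κ ≠ 0 ∧ ∀ n, ∀ f ∈ wordSpan k (levelWords lam n w),
      (dX lam f).coeff (diffPow lam (n + 1) w) = κ * f.coeff (diffPow lam n w) := by
  suffices H : ∃ κ : k, κ ≠ 0 ∧ ∀ n, ∀ v ∈ levelWords lam n w,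
      (dX lam (ncWord k v)).coeff (diffPow lam (n + 1) w) =
        κ * (ncWord k v).coeff (diffPow lam n w) by
    obtain ⟨κ, hκ, h⟩ := H
    refine ⟨κ, hκ, fun n f hf => ?_⟩
    have := map_mem_of_wordSpan (P := ⊥)
      (Finsupp.lapply (diffPow lam (n + 1) w) ∘ₗ (MonoidAlgebra.coeffLinearEquiv k).toLinearMap ∘ₗ
        dX lam - κ • (Finsupp.lapply (diffPow lam n w) ∘ₗ
          (MonoidAlgebra.coeffLinearEquiv k).toLinearMap)) (fun v hv => ?_) hf
    · exact sub_eq_zero.1 this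
    · exact sub_eq_zero.2 (h n v hv)
  by_cases hlam : lam = 0
  · subst hlam
    refine ⟨1, one_ne_zero, fun n v _ => ?_⟩
    cases w using FreeMonoid.casesOn with
    | one => exact absurd rfl hw
    | of_mul x w =>
      rw [dX_ncWord, diffPow_zero_of_mul, diffPow_zero_of_mul, coeff_dWord_zero, one_mul]
      rfl
  · refine ⟨lam ^ (w.length - 1), pow_ne_zero _ hlam, fun n v hv => ?_⟩
    rw [dX_ncWord, diffPow_of_ne hlam, diffPow_of_ne hlam, coeff_dWord_of_ne n _ hv.2.1 w hw]
    rfl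

theorem map_fst_diffPow (lam : k) (n : ℕ) (w : FreeMonoid X) :
    FreeMonoid.map Prod.fst (diffPow lam n w) = w := by
  by_cases hlam : lam = 0
  · subst hlam
    cases w using FreeMonoid.casesOn with
    | one => rw [diffPow_one, map_one]
    | of_mul x w =>
      rw [diffPow_zero_of_mul, map_mul, FreeMonoid.map_of]
      congr 1
      exact (List.map_map).trans (List.map_id _)
  · rw [diffPow_of_ne hlam]
    exact (List.map_map).trans (List.map_id _)

theorem diffPow_zero (lam : k) (w : FreeMonoid X) :
    diffPow lam 0 w = FreeMonoid.map (fun x => (x, 0)) w := by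
  by_cases hlam : lam = 0
  · subst hlam
    cases w using FreeMonoid.casesOn with
    | one => rw [diffPow_one, map_one]
    | of_mul x w => rw [diffPow_zero_of_mul, map_mul, FreeMonoid.map_of]
  · rw [diffPow_of_ne hlam]

theorem coeff_dX_iterate_ne_zero (lam : k) {n : ℕ} {w : FreeMonoid X} (hw : w ≠ 1 ∨ n = 0) :
    ((dX lam)^[n] (hatEmbedding (ncWord k w))).coeff (diffPow lam n w) ≠ 0 := by
  induction n with
  | zero =>
    rw [Function.iterate_zero_apply, diffPow_zero]
    change (letterHom k (fun x => (x, 0)) (ncWord k w)).coeff _ ≠ 0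
    rw [letterHom_ncWord, coeff_ncWord_self]
    exact one_ne_zero
  | succ n ih =>
    have hw : w ≠ 1 := hw.resolve_right n.succ_ne_zero
    obtain ⟨κ, hκ, h⟩ := exists_coeff_dX lam hw
    rw [Function.iterate_succ_apply', h n _ (dX_iterate_mem lam n w)]
    exact mul_ne_zero hκ (ih (Or.inl hw))

/-- `lt` is an order on differential words for which the `n`-th differential of a polynomial with
leading word `t` has leading word `t^{[n]}`. -/
def CompatibleWith (lam : k) (ltX : FreeMonoid X → FreeMonoid X → Prop)
    (lt : FreeMonoid (X × ℕ) → FreeMonoid (X × ℕ) → Prop) : Prop :=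
  ∀ (n : ℕ) (w t : FreeMonoid X), (w = t ∨ ltX w t) → ∀ v ∈ levelWords lam n w,
    v ≠ diffPow lam n t → lt v (diffPow lam n t)

/-- The operator preserves the underlying word in `X`, so `t^[n]` can only come from the word `t` of
`s` and nothing cancels it; all other words are controlled by `CompatibleWith`. The alternative `n =
0` covers the empty word, which every differential kills. -/
theorem isLeadingWord_dX_iterate {lam : k} {ltX : FreeMonoid X → FreeMonoid X → Prop}
    {lt : FreeMonoid (X × ℕ) → FreeMonoid (X × ℕ) → Prop} (hlt : CompatibleWith lam ltX lt)
    {s : NCPoly k X} {t : FreeMonoid X} (hs : IsLeadingWord ltX s t) {n : ℕ}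
    (ht : t ≠ 1 ∨ n = 0) :
    IsLeadingWord lt ((dX lam)^[n] (hatEmbedding s)) (diffPow lam n t) := by
  let F : NCPoly k X →ₗ[k] NCPoly k (X × ℕ) := (dX lam ^ n) ∘ₗ hatEmbedding.toLinearMap
  have hF : ∀ f, F f = (dX lam)^[n] (hatEmbedding f) := fun f => by
    simp only [F, LinearMap.comp_apply, Module.End.pow_apply, AlgHom.toLinearMap_apply]
  rw [← hF]
  constructor
  · have h1 : F (s - s.coeff t • ncWord k t) ∈
        wordSpan k {v | FreeMonoid.map Prod.fst v ≠ t} := by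
      refine map_mem_of_wordSpan (s := {w | w ≠ t}) F (fun w hw => ?_)
        (mem_wordSpan_iff.2 fun w hw => ?_)
      · rw [hF]
        refine wordSpan_mono ?_ (dX_iterate_mem lam n w)
        rintro v ⟨h, -, -⟩
        exact fun h' => hw (h.symm.trans h')
      · rintro rfl
        apply hw
        rw [MonoidAlgebra.coeff_sub, Finsupp.sub_apply, MonoidAlgebra.coeff_smul_apply,
          coeff_ncWord_self, smul_eq_mul, mul_one, sub_self]
    have h2 : (F (s - s.coeff t • ncWord k t)).coeff (diffPow lam n t) = 0 := by
      by_contra h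
      exact mem_wordSpan_iff.1 h1 _ h (map_fst_diffPow lam n t)
    rw [map_sub, map_smul, MonoidAlgebra.coeff_sub, Finsupp.sub_apply,
      MonoidAlgebra.coeff_smul_apply, sub_eq_zero] at h2
    rw [h2, hF]
    exact mul_ne_zero hs.1 (coeff_dX_iterate_ne_zero lam ht)
  · have h1 : F s ∈ wordSpan k {v | ∃ w, s.coeff w ≠ 0 ∧ v ∈ levelWords lam n w} := by
      refine map_mem_of_wordSpan (s := {w | s.coeff w ≠ 0}) F (fun w hw => ?_)
        (mem_wordSpan_iff.2 fun w hw => hw)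
      rw [hF]
      refine wordSpan_mono ?_ (dX_iterate_mem lam n w)
      exact fun v hv => ⟨w, hw, hv⟩
    intro v hv hne
    obtain ⟨w, hw, hvw⟩ := mem_wordSpan_iff.1 h1 v hv
    refine hlt n w t ?_ v hvw hne
    by_cases hwt : w = t
    · exact Or.inl hwt
    · exact Or.inr (hs.2 w hw hwt)

/-! ### Compatible orders on differential words -/

/-- `levelPart n` deletes the letters of level below `n`, and deleting letters makes a word smaller,
since `1` is least and the order is multiplicative. -/
theorem eq_map_or_lt_levelPart (ord : WordOrder X) (n : ℕ) (v : FreeMonoid (X × ℕ))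
    (hv : ∀ p ∈ FreeMonoid.toList v, p.2 ≤ n) :
    v = FreeMonoid.map (fun x => (x, n)) (FreeMonoid.map Prod.fst v) ∨
      ord.lt (levelPart n v) (FreeMonoid.map Prod.fst v) := by
  have hlt := rewriteOrder_of_wordOrder ord
  induction v using FreeMonoid.inductionOn' with
  | one => exact Or.inl rfl
  | of_mul p v ih =>
    obtain ⟨x, j⟩ := p
    have hv' : ∀ p ∈ FreeMonoid.toList v, p.2 ≤ n := fun p hp => hv p (List.mem_cons_of_mem _ hp)
    have hj : j ≤ n := hv (x, j) List.mem_cons_self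
    rw [map_of_mul, map_of_mul, map_mul, levelPart_of]
    rcases hj.eq_or_lt with rfl | hj
    · rw [if_pos rfl]
      rcases ih hv' with h | h
      · exact Or.inl (congrArg (FreeMonoid.of (x, j) * ·) h)
      · exact Or.inr (hlt.mul_left _ h)
    · rw [if_neg hj.ne, one_mul]
      have h1 : ord.lt (FreeMonoid.map Prod.fst v)
          (FreeMonoid.of x * FreeMonoid.map Prod.fst v) := by
        simpa using hlt.mul_right (FreeMonoid.map Prod.fst v)
          (ord.one_lt _ (FreeMonoid.of_ne_one x))
      rcases ih hv' with h | h
      · have h2 : levelPart n v = FreeMonoid.map Prod.fst v := by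
          conv_lhs => rw [h, levelPart_map, if_pos rfl]
        exact Or.inr (by rw [h2]; exact h1)
      · exact Or.inr (hlt.trans h h1)

theorem levelPart_eq_one {n m : ℕ} (hm : n < m) {v : FreeMonoid (X × ℕ)}
    (hv : ∀ p ∈ FreeMonoid.toList v, p.2 ≤ n) : levelPart m v = 1 := by
  induction v using FreeMonoid.inductionOn' with
  | one => exact map_one _
  | of_mul p v ih =>
    have hp : p.2 ≤ n := hv p List.mem_cons_self
    rw [map_mul, levelPart_of, if_neg (by omega), one_mul,
      ih fun p hp => hv p (List.mem_cons_of_mem _ hp)]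

/-- No level above `n` occurs, so level `n` decides: there `t^[n]` has all of `t`, while `v` has a
part of `w`, with `w` at most `t`. -/
theorem levelLT_compatible (ord : WordOrder X) {lam : k} (hlam : lam ≠ 0) :
    CompatibleWith lam ord.lt (levelLT ord) := by
  rintro n w t hwt v ⟨rfl, h2, -⟩ hne
  rw [diffPow_of_ne hlam] at hne ⊢
  rcases eq_map_or_lt_levelPart ord n v h2 with h | h
  · rcases hwt with rfl | hwt
    · exact absurd h hne
    · rw [h]
      exact levelLT_map n hwt
  · refine ⟨n, ?_, fun m hm => ?_⟩
    · simp only [levelPart_map, if_true]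
      rcases hwt with rfl | hwt
      · exact h
      · exact (rewriteOrder_of_wordOrder ord).trans h hwt
    · simp only [levelPart_map, if_neg hm.ne]
      exact levelPart_eq_one hm h2

theorem levelSum_of_mul (p : X × ℕ) (v : FreeMonoid (X × ℕ)) :
    levelSum (FreeMonoid.of p * v) = p.2 + levelSum v := rfl

theorem eq_map_of_levelSum {v : FreeMonoid (X × ℕ)} (h : levelSum v = 0) :
    v = FreeMonoid.map (fun x => (x, 0)) (FreeMonoid.map Prod.fst v) := by
  induction v using FreeMonoid.inductionOn' with
  | one => rfl
  | of_mul p v ih =>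
    obtain ⟨x, j⟩ := p
    rw [levelSum_of_mul] at h
    obtain ⟨h1, h2⟩ := Nat.add_eq_zero_iff.1 h
    obtain rfl : j = 0 := h1
    exact congrArg (FreeMonoid.of (x, 0) * ·) (ih h2)

theorem markWord_map_zero (w : FreeMonoid X) :
    markWord (FreeMonoid.map (fun x => (x, 0)) w) = FreeMonoid.map some w := by
  induction w using FreeMonoid.inductionOn' with
  | one => rfl
  | of_mul x w ih => rw [map_of_mul, map_of_mul, markWord_of_mul, pow_zero, one_mul, ih]

theorem markWord_diffPow {w : FreeMonoid X} (hw : w ≠ 1) (n : ℕ) :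
    markWord (diffPow (0 : k) n w) = FreeMonoid.of none ^ n * FreeMonoid.map some w := by
  cases w using FreeMonoid.casesOn with
  | one => exact absurd rfl hw
  | of_mul x w =>
    rw [diffPow_zero_of_mul, markWord_of_mul, markWord_map_zero, map_of_mul]

theorem blockPart_diffPow (w : FreeMonoid X) (n m : ℕ) :
    blockPart (markWord (diffPow (0 : k) n w)) m = if n = m then w else 1 := by
  by_cases hw : w = 1
  · subst hw
    rw [diffPow_one, map_one, blockPart_one, ite_self]
  · rw [markWord_diffPow hw, blockPart_pow, blockPart_map_some]
    by_cases h : n = m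
    · simp [h]
    · rw [if_neg h]
      split_ifs
      · omega
      all_goals rfl

theorem markDeg_markWord (v : FreeMonoid (X × ℕ)) : markDeg (markWord v) = levelSum v := by
  induction v using FreeMonoid.inductionOn' with
  | one => rfl
  | of_mul p v ih => rw [markWord_of_mul, markDeg_pow, markDeg_some, ih, levelSum_of_mul]

/-- The marked word has `levelSum v` marks, so this is its last block, the letters after the last
mark. It omits some letter unless all marks precede the first letter, which is the case `v = w^[n]`.
-/
theorem eq_diffPow_or_lt_blockPart (k : Type u) [Field k] (ord : WordOrder X)
    (v : FreeMonoid (X × ℕ)) :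
    v = diffPow (0 : k) (levelSum v) (FreeMonoid.map Prod.fst v) ∨
      ord.lt (blockPart (markWord v) (levelSum v)) (FreeMonoid.map Prod.fst v) := by
  have hlt := rewriteOrder_of_wordOrder ord
  induction v using FreeMonoid.inductionOn' with
  | one => exact Or.inl (diffPow_one _ _).symm
  | of_mul p v ih =>
    obtain ⟨x, j⟩ := p
    rw [map_of_mul, levelSum_of_mul, markWord_of_mul, blockPart_pow,
      if_pos (Nat.le_add_right _ _), Nat.add_sub_cancel_left]
    by_cases hs : levelSum v = 0
    · left
      rw [hs, add_zero, diffPow_zero_of_mul, ← eq_map_of_levelSum hs]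
    · right
      obtain ⟨n, hn⟩ := Nat.exists_eq_succ_of_ne_zero hs
      have h1 : ord.lt (FreeMonoid.map Prod.fst v)
          (FreeMonoid.of x * FreeMonoid.map Prod.fst v) := by
        simpa using hlt.mul_right (FreeMonoid.map Prod.fst v)
          (ord.one_lt _ (FreeMonoid.of_ne_one x))
      rw [hn, Nat.succ_eq_add_one, blockPart_some_succ, ← Nat.succ_eq_add_one, ← hn]
      rcases ih with h | h
      · have h2 : blockPart (markWord v) (levelSum v) = FreeMonoid.map Prod.fst v := by
          have := blockPart_diffPow (k := k) (FreeMonoid.map Prod.fst v) (levelSum v) (levelSum v)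
          rwa [← h, if_pos rfl] at this
        rw [h2]
        exact h1
      · exact hlt.trans h h1

/-- The order on differential words used for weight zero. -/
def markLT (ord : WordOrder X) (v w : FreeMonoid (X × ℕ)) : Prop :=
  blockLT ord (markWord v) (markWord w)

theorem markLT_rewriteOrder (ord : WordOrder X) : RewriteOrder (markLT ord) where
  wf := InvImage.wf _ (blockLT_rewriteOrder ord).wf
  trans := fun h h' => (blockLT_rewriteOrder ord).trans h h'
  mul := fun a u v b h => by
    rw [markLT, map_mul, map_mul, map_mul, map_mul]
    exact (blockLT_rewriteOrder ord).mul _ _ h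

theorem markLT_compatible (k : Type u) [Field k] (ord : WordOrder X) :
    CompatibleWith (0 : k) ord.lt (markLT ord) := by
  rintro n w t hwt v ⟨rfl, -, h3⟩ hne
  obtain rfl := h3 rfl
  have ht : t ≠ 1 := by
    rintro rfl
    have h1 : FreeMonoid.map Prod.fst v = 1 := hwt.resolve_right (not_lt_one ord _)
    have h2 : v = 1 := List.map_eq_nil_iff.1 h1
    exact hne (h2.trans (diffPow_one _ _).symm)
  refine ⟨?_, levelSum v, ?_, fun m hm => ?_⟩
  · rw [markWord_diffPow ht, markDeg_pow, markDeg_map_some, markDeg_markWord, add_zero]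
  · rw [blockPart_diffPow, if_pos rfl]
    rcases eq_diffPow_or_lt_blockPart k ord v with h | h
    · rcases hwt with rfl | hwt
      · exact absurd h hne
      · have h2 : blockPart (markWord v) (levelSum v) = FreeMonoid.map Prod.fst v := by
          have := blockPart_diffPow (k := k) (FreeMonoid.map Prod.fst v) (levelSum v) (levelSum v)
          rwa [← h, if_pos rfl] at this
        rw [h2]
        exact hwt
    · rcases hwt with rfl | hwt
      · exact h
      · exact (rewriteOrder_of_wordOrder ord).trans h hwt
  · rw [blockPart_diffPow, if_neg hm.ne]
    exact blockPart_eq_one (by rwa [markDeg_markWord])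

/-- At the first position of level below `n` the level decides in favour of `t`; before it the
comparison is that of the letters of `X`. -/
theorem eq_or_lex_map (r : X → X → Prop) (n : ℕ) (v : List (X × ℕ)) (t : List X)
    (hv : ∀ p ∈ v, p.2 ≤ n) (hlen : v.length = t.length)
    (h : v.map Prod.fst = t ∨ List.Lex r (v.map Prod.fst) t) :
    v = t.map (fun x => (x, n)) ∨ List.Lex (deltaLT r) v (t.map fun x => (x, n)) := by
  induction v generalizing t with
  | nil =>
    obtain rfl := List.length_eq_zero_iff.1 hlen.symm
    exact Or.inl rfl
  | cons p v ih =>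
    obtain ⟨x, j⟩ := p
    cases t with
    | nil => simp at hlen
    | cons y t =>
      have hj : j ≤ n := hv (x, j) List.mem_cons_self
      rcases hj.eq_or_lt with rfl | hj
      · have hrec : x = y → (v.map Prod.fst = t ∨ List.Lex r (v.map Prod.fst) t) →
            (x, j) :: v = (y :: t).map (fun x => (x, j)) ∨
              List.Lex (deltaLT r) ((x, j) :: v) ((y :: t).map fun x => (x, j)) := by
          rintro rfl h
          rcases ih t (fun p hp => hv p (List.mem_cons_of_mem _ hp)) (by simpa using hlen) h
            with h | h
          · exact Or.inl (congrArg (List.cons (x, j)) h)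
          · exact Or.inr (List.Lex.cons h)
        rcases h with h | h
        · obtain ⟨h1, h2⟩ := List.cons.inj h
          exact hrec h1 (Or.inl h2)
        · cases h with
          | rel h => exact Or.inr (List.Lex.rel (Or.inr ⟨rfl, h⟩))
          | cons h => exact hrec rfl (Or.inr h)
      · exact Or.inr (List.Lex.rel (Or.inl hj))

/-- Lengths are preserved, so only the lexicographic comparison is at issue. For `lam = 0` the first
letter either has level below `n`, which decides, or has level `n`, which forces level `0` on all
others as the levels sum to `n`. -/
theorem degLex_compatible (lam : k) (r : X → X → Prop) :
    CompatibleWith lam (degLex r) (degLex (deltaLT r)) := by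
  rintro n w t hwt v ⟨rfl, h2, h3⟩ hne
  have hlen : (FreeMonoid.toList (diffPow lam n t)).length = (FreeMonoid.toList t).length := by
    conv_rhs => rw [← map_fst_diffPow lam n t, FreeMonoid.toList_map, List.length_map]
  have hlen' : (FreeMonoid.toList (FreeMonoid.map Prod.fst v)).length =
      (FreeMonoid.toList v).length := List.length_map _
  have hmain : (FreeMonoid.toList v).length = (FreeMonoid.toList t).length →
      (FreeMonoid.map Prod.fst v = t ∨
        List.Lex r ((FreeMonoid.toList v).map Prod.fst) (FreeMonoid.toList t)) →
      degLex (deltaLT r) v (diffPow lam n t) := by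
    intro hl h
    refine List.shortlex_def.2 (Or.inr ⟨hl.trans hlen.symm, ?_⟩)
    by_cases hlam : lam = 0
    · subst hlam
      cases v using FreeMonoid.casesOn with
      | one =>
        obtain rfl : t = 1 := List.length_eq_zero_iff.1 hl.symm
        exact absurd (diffPow_one _ _).symm hne
      | of_mul p v =>
        obtain ⟨x, j⟩ := p
        cases t using FreeMonoid.casesOn with
        | one => exact absurd (List.length_eq_zero_iff.1 hl) (List.cons_ne_nil _ _)
        | of_mul y t =>
          have hj : j ≤ n := h2 (x, j) List.mem_cons_self
          have hs : j + levelSum v = n := h3 rfl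
          rw [diffPow_zero_of_mul] at hne ⊢
          rcases hj.eq_or_lt with rfl | hj
          · have hv := eq_map_of_levelSum (v := v) (by omega)
            have hv0 : ∀ p ∈ FreeMonoid.toList v, p.2 ≤ 0 := by
              rw [hv]
              exact (map_mem_levelWords_zero (0 : k) (FreeMonoid.map Prod.fst v)).2.1
            have hrec : x = y → (FreeMonoid.map Prod.fst v = t ∨
                List.Lex r ((FreeMonoid.toList v).map Prod.fst) (FreeMonoid.toList t)) →
                List.Lex (deltaLT r) (FreeMonoid.toList (FreeMonoid.of (x, j) * v))
                  (FreeMonoid.toList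
                    (FreeMonoid.of (y, j) * FreeMonoid.map (fun y => (y, 0)) t)) := by
              rintro rfl h
              rcases eq_or_lex_map r 0 (FreeMonoid.toList v) (FreeMonoid.toList t) hv0
                (Nat.succ.inj hl) h with h | h
              · exact absurd (congrArg (FreeMonoid.of (x, j) * ·) h) hne
              · exact List.Lex.cons h
            rcases h with h | h
            · obtain ⟨h1, h2⟩ := of_mul_inj h
              exact hrec h1 (Or.inl h2)
            · cases h with
              | rel h => exact List.Lex.rel (Or.inr ⟨rfl, h⟩)
              | cons h => exact hrec rfl (Or.inr h)
          · exact List.Lex.rel (Or.inl hj)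
    · rw [diffPow_of_ne hlam] at hne ⊢
      exact (eq_or_lex_map r n _ _ h2 hl h).resolve_left hne
  rcases hwt with rfl | hwt
  · exact hmain hlen'.symm (Or.inl rfl)
  · rcases List.shortlex_def.1 hwt with h | ⟨h, h'⟩
    · exact List.Shortlex.of_length_lt (by rw [hlen, ← hlen']; exact h)
    · exact hmain (hlen'.symm.trans h) (Or.inr h')

theorem degLex_deltaLT_asymm {r : X → X → Prop} (hr : IsWellOrder X r) :
    ∀ u v : FreeMonoid (X × ℕ), degLex (deltaLT r) u v → ¬ degLex (deltaLT r) v u := by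
  have h : Std.Asymm (deltaLT r) := by
    refine ⟨?_⟩
    rintro p q (h | ⟨h, h'⟩) (g | ⟨g, g'⟩)
    · omega
    · omega
    · omega
    · exact hr.wf.asymmetric _ _ h' g'
  intro u v huv hvu
  exact (inferInstance : Std.Asymm (List.Shortlex (deltaLT r))).asymm _ _ huv hvu

/-! ### The avoiding words span -/

section Spanning

variable {A D : Type u} [Ring A] [Algebra k A] [Ring D] [Algebra k D] {lam : k} {d : D →ₗ[k] D}
  {i : A →ₐ[k] D} {π : NCPoly k X →ₐ[k] A}

/-- The evaluation of differential polynomials in `D`. -/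
def diffEval (d : D →ₗ[k] D) (e : X → D) : NCPoly k (X × ℕ) →ₐ[k] D :=
  MonoidAlgebra.lift k D (FreeMonoid (X × ℕ)) (diffWordEval d e)

theorem diffEval_ncWord (d : D →ₗ[k] D) (e : X → D) (w : FreeMonoid (X × ℕ)) :
    diffEval d e (ncWord k w) = diffWordEval d e w :=
  MonoidAlgebra.lift_of _ _

theorem diffEval_dX (hd : IsDiffOp lam d) (e : X → D) (f : NCPoly k (X × ℕ)) :
    diffEval d e (dX lam f) = d (diffEval d e f) := by
  have h : (diffEval d e).toLinearMap ∘ₗ dX lam = d ∘ₗ (diffEval d e).toLinearMap := by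
    refine linearMap_ext_words fun w => ?_
    simp only [LinearMap.comp_apply, AlgHom.toLinearMap_apply, dX_ncWord]
    induction w using FreeMonoid.inductionOn' with
    | one =>
      rw [ncWord_one, map_one (diffEval d e), hd.map_one]
      exact map_zero _
    | of_mul p w ih =>
      have h1 : diffEval d e (ncWord k (FreeMonoid.of (p.1, p.2 + 1))) =
          d (diffEval d e (ncWord k (FreeMonoid.of p))) := by
        rw [diffEval_ncWord, diffEval_ncWord, diffWordEval, FreeMonoid.lift_eval_of,
          FreeMonoid.lift_eval_of, Function.iterate_succ_apply']
      rw [FreeMonoid.toList_of_mul, dWord, ncWord_mul, map_mul, hd.leibniz, map_add, map_add,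
        map_smul, map_mul, map_mul, map_mul, ih, h1, FreeMonoid.ofList_toList]
  exact LinearMap.congr_fun h f

theorem diffEval_dX_iterate (hd : IsDiffOp lam d) (e : X → D) (n : ℕ) (f : NCPoly k (X × ℕ)) :
    diffEval d e ((dX lam)^[n] f) = d^[n] (diffEval d e f) :=
  (Function.Semiconj.iterate_right (f := diffEval d e) (ga := dX lam) (gb := d)
    (diffEval_dX hd e) n) f

theorem diffEval_hatEmbedding (d : D →ₗ[k] D) (g : NCPoly k X →ₐ[k] D) (f : NCPoly k X) :
    diffEval d (fun x => g (ncWord k (FreeMonoid.of x))) (hatEmbedding f) = g f := by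
  have h : (diffEval d fun x => g (ncWord k (FreeMonoid.of x))).toLinearMap ∘ₗ
      (letterHom k fun x => (x, 0)).toLinearMap = g.toLinearMap := by
    refine linearMap_ext_words fun w => ?_
    simp only [LinearMap.comp_apply, AlgHom.toLinearMap_apply, letterHom_ncWord, diffEval_ncWord]
    induction w using FreeMonoid.inductionOn' with
    | one => rw [ncWord_one, map_one, map_one, map_one]
    | of_mul x w ih =>
      rw [map_of_mul, map_mul, ih, ncWord_mul, map_mul, diffWordEval, FreeMonoid.lift_eval_of,
        Function.iterate_zero_apply]
  exact LinearMap.congr_fun h f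

/-- The range is a differential subalgebra containing the image of `A`. Freeness gives a map from
`D` to it, and by uniqueness its composite with the inclusion is the identity of `D`. -/
theorem diffEval_surjective (hD : IsFreeDiffAlgebra lam d i) (hπ : Function.Surjective π) :
    Function.Surjective (diffEval d fun x => i (π (ncWord k (FreeMonoid.of x)))) := by
  set Φ := diffEval d fun x => i (π (ncWord k (FreeMonoid.of x))) with hΦ
  let E : Subalgebra k D := Φ.range
  have hdE : ∀ x ∈ Subalgebra.toSubmodule E, d x ∈ Subalgebra.toSubmodule E := by
    rintro _ ⟨f, rfl⟩
    exact ⟨dX lam f, diffEval_dX hD.isDiffOp _ f⟩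
  let dE : E →ₗ[k] E := d.restrict hdE
  have hdE' : IsDiffOp lam dE :=
    { leibniz := fun x y => Subtype.ext (hD.isDiffOp.leibniz x y)
      map_one := Subtype.ext hD.isDiffOp.map_one }
  have hi : ∀ a, i a ∈ E := fun a => by
    obtain ⟨f, rfl⟩ := hπ a
    exact ⟨hatEmbedding f, diffEval_hatEmbedding d (i.comp π) f⟩
  obtain ⟨ψ, ⟨hψ, hψi⟩, -⟩ := hD.universal E dE hdE' (i.codRestrict E hi)
  obtain ⟨χ, -, huniq⟩ := hD.universal D d hD.isDiffOp i
  have h1 : E.val.comp ψ = χ := huniq _ ⟨fun x => by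
      rw [AlgHom.comp_apply, hψ]
      rfl, by
      rw [AlgHom.comp_assoc, hψi]
      rfl⟩
  have h2 : AlgHom.id k D = χ := huniq _ ⟨fun x => rfl, AlgHom.id_comp i⟩
  intro x
  have h3 : x = (ψ x : D) := DFunLike.congr_fun (h2.trans h1.symm) x
  obtain ⟨f, hf⟩ := (ψ x).2
  exact ⟨f, hf.trans h3.symm⟩

/-- Well-founded induction on words: a word `a t^[n] b` is the leading word of `a d^n(s) b`, whose
value in `D` is zero, so its value is a combination of values of smaller words. -/
theorem span_avoidingWords (hD : IsFreeDiffAlgebra lam d i) (hπ : Function.Surjective π)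
    {ltX : FreeMonoid X → FreeMonoid X → Prop} {S : Set (NCPoly k X)} (hS : ∀ s ∈ S, π s = 0)
    (h1 : ∀ s ∈ S, ¬ IsLeadingWord ltX s 1)
    {lt : FreeMonoid (X × ℕ) → FreeMonoid (X × ℕ) → Prop} (hlt : RewriteOrder lt)
    (hcomp : CompatibleWith lam ltX lt) :
    ⊤ ≤ Submodule.span k (Set.range fun z : avoidingWords lam ltX S =>
      diffWordEval d (fun x : X => i (π (ncWord k (FreeMonoid.of x)))) z.1) := by
  set e : X → D := fun x => i (π (ncWord k (FreeMonoid.of x))) with he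
  set V := Submodule.span k (Set.range fun z : avoidingWords lam ltX S => diffWordEval d e z.1)
    with hV
  have key : ∀ w, diffEval d e (ncWord k w) ∈ V := by
    intro w
    induction w using hlt.wf.induction with
    | _ w ih =>
      by_cases hw : w ∈ avoidingWords lam ltX S
      · rw [diffEval_ncWord]
        exact Submodule.subset_span ⟨⟨w, hw⟩, rfl⟩
      · have hw' : ∃ s ∈ S, ∃ t, IsLeadingWord ltX s t ∧ ∃ n a b,
            w = a * diffPow lam n t * b := by
          by_contra hcon
          push Not at hcon
          exact hw fun s hs t ht n a b => hcon s hs t ht n a b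
        obtain ⟨s, hs, t, ht, n, a, b, rfl⟩ := hw'
        have hlead := isLeadingWord_dX_iterate hcomp ht (n := n) (Or.inl fun h => by
          rw [h] at ht
          exact h1 s hs ht)
        have hword : ∀ u : FreeMonoid (X × ℕ), LeadsTo lt (ncWord k u) u 1 := fun u => by
          rw [LeadsTo, one_smul, sub_self]
          exact zero_mem _
        have h2 := ((hword a).mul hlt (leadsTo_of_isLeadingWord hlead)).mul hlt (hword b)
        rw [one_mul, mul_one] at h2
        have h3 := map_mem_of_wordSpan (diffEval d e).toLinearMap ih h2
        have h4 : diffEval d e ((dX lam)^[n] (hatEmbedding s)) = 0 := by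
          rw [diffEval_dX_iterate hD.isDiffOp]
          have h5 : diffEval d e (hatEmbedding s) = 0 := by
            rw [show diffEval d e (hatEmbedding s) = i (π s) from
              diffEval_hatEmbedding d (i.comp π) s, hS s hs, map_zero]
          rw [h5]
          exact Function.iterate_fixed (map_zero d) n
        rw [AlgHom.toLinearMap_apply, map_sub, map_smul, map_mul, map_mul, h4, mul_zero, zero_mul,
          zero_sub] at h3
        exact (Submodule.smul_mem_iff _ hlead.1).1 (neg_mem_iff.1 h3)
  intro x _
  obtain ⟨f, rfl⟩ := diffEval_surjective hD hπ x
  exact map_mem_of_wordSpan (diffEval d e).toLinearMap (fun w _ => key w) (mem_wordSpan_univ f)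

end Spanning

/-! ### Deg-lex irreducible words and the basis theorem -/

theorem avoidingWords_eq_empty {lam : k} {lt : FreeMonoid X → FreeMonoid X → Prop}
    {S : Set (NCPoly k X)} {s : NCPoly k X} (hs : s ∈ S) (h : IsLeadingWord lt s 1) :
    avoidingWords lam lt S = ∅ :=
  Set.eq_empty_of_forall_notMem fun z hz => hz s hs 1 h 0 z 1 (by simp [diffPow_one])

theorem dIrr_eq_avoidingWords (lam : k) {r : X → X → Prop} (hr : IsWellOrder X r)
    {S : Set (NCPoly k X)} (hS : ∀ s ∈ S, ∃ t, IsLeadingWord (degLex r) s t) :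
    DIrr lam (degLex (deltaLT r)) (hatEmbedding '' S) = avoidingWords lam (degLex r) S := by
  have hcomp := degLex_compatible lam r
  ext z
  constructor
  · intro hz s hs t ht n a b h
    by_cases ht1 : t = 1
    · subst ht1
      have h0 := isLeadingWord_dX_iterate hcomp ht (n := 0) (Or.inr rfl)
      rw [diffPow_one] at h0
      exact hz _ ⟨s, hs, rfl⟩ 0 1 h0 z 1 (by simp)
    · exact hz _ ⟨s, hs, rfl⟩ n _ (isLeadingWord_dX_iterate hcomp ht (Or.inl ht1)) a b h
  · rintro hz _ ⟨s, hs, rfl⟩ n t' ht' a b h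
    obtain ⟨t, ht⟩ := hS s hs
    by_cases ht1 : t = 1
    · subst ht1
      exact hz s hs 1 ht 0 z 1 (by simp [diffPow_one])
    · have h0 := isLeadingWord_dX_iterate hcomp ht (n := n) (Or.inl ht1)
      obtain rfl := isLeadingWord_unique (degLex_deltaLT_asymm hr) ht' h0
      exact hz s hs t ht n a b h

theorem eq_one_of_isLeadingWord_one {ord : WordOrder X} {s : NCPoly k X}
    (h : IsLeadingWord ord.lt s 1) (h1 : s.coeff 1 = 1) : s = 1 := by
  refine MonoidAlgebra.ext (Finsupp.ext fun w => ?_)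
  rw [← ncWord_one]
  by_cases hw : w = 1
  · subst hw
    rw [h1, coeff_ncWord_self]
  · rw [coeff_ncWord_ne (Ne.symm hw)]
    by_contra hne
    exact not_lt_one ord w (h.2 w hne hw)

theorem exists_basis_avoidingWords {A D : Type u} [Ring A] [Algebra k A] [Ring D] [Algebra k D]
    {π : NCPoly k X →ₐ[k] A} (hπ : Function.Surjective π) {ord : WordOrder X}
    {S : Set (NCPoly k X)} (hS : IsGSBasisOf ord S (TwoSidedIdeal.ker π))
    {lam : k} {d : D →ₗ[k] D} {i : A →ₐ[k] D} (hD : IsFreeDiffAlgebra lam d i) :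
    ∃ b : Module.Basis (avoidingWords lam ord.lt S) k D,
      ∀ z : avoidingWords lam ord.lt S,
        b z = diffWordEval d (fun x : X => i (π (ncWord k (FreeMonoid.of x)))) z.1 := by
  have hker : ∀ s ∈ S, π s = 0 := fun s hs => by
    rw [← TwoSidedIdeal.mem_ker π, ← hS.2]
    exact TwoSidedIdeal.subset_span hs
  by_cases h1 : ∀ s ∈ S, ¬ IsLeadingWord ord.lt s 1
  · have hspan : ⊤ ≤ Submodule.span k (Set.range fun z : avoidingWords lam ord.lt S =>
        diffWordEval d (fun x : X => i (π (ncWord k (FreeMonoid.of x)))) z.1) := by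
      by_cases hlam : lam = 0
      · subst hlam
        exact span_avoidingWords hD hπ hker h1 (markLT_rewriteOrder ord) (markLT_compatible k ord)
      · exact span_avoidingWords hD hπ hker h1 (levelLT_rewriteOrder ord)
          (levelLT_compatible ord hlam)
    exact ⟨Module.Basis.mk (linearIndependent_avoidingWords hD hπ hS h1) hspan,
      fun z => Module.Basis.mk_apply _ _ z⟩
  -- The degenerate case: `1 ∈ S`, so `A` and hence `D` are zero, and the empty family is a basis.
  · push Not at h1
    obtain ⟨s, hs, hlead⟩ := h1
    have hs1 := eq_one_of_isLeadingWord_one hlead (monic_of_isGSBasis hS.1 hs hlead)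
    have h0 : (1 : D) = 0 := by
      rw [← map_one i, ← map_one π, ← hs1, hker s hs, map_zero]
    have hsub : Subsingleton D := subsingleton_of_zero_eq_one h0.symm
    have hempty : IsEmpty (avoidingWords lam ord.lt S) := by
      rw [avoidingWords_eq_empty hs hlead]
      infer_instance
    exact ⟨Module.Basis.empty D, fun z => Subsingleton.elim _ _⟩

end NCDiff
end

theorem mainTheorem2 {k X A D : Type u} [Field k] [CharZero k] [Ring A] [Algebra k A]
    [Ring D] [Algebra k D]
    -- a presentation of `A` by generators `X`, and a Gröbner–Shirshov basis of its relation ideal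
    (π : NCPoly k X →ₐ[k] A) (hπ : Function.Surjective π)
    (ord : WordOrder X) (S : Set (NCPoly k X)) (hS : IsGSBasisOf ord S (TwoSidedIdeal.ker π))
    -- a free differential algebra of weight `lam` on `A`
    (lam : k) (d : D →ₗ[k] D) (i : A →ₐ[k] D) (hD : IsFreeDiffAlgebra lam d i) :
    (∃ b : Module.Basis (avoidingWords lam ord.lt S) k D,
      ∀ z : avoidingWords lam ord.lt S,
        b z = diffWordEval d (fun x : X => i (π (ncWord k (FreeMonoid.of x)))) z.1) ∧
    (∀ r : X → X → Prop, IsWellOrder X r → ord.lt = degLex r →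
      DIrr lam (degLex (deltaLT r)) (hatEmbedding '' S) = avoidingWords lam ord.lt S) := by
  refine ⟨NCDiff.exists_basis_avoidingWords hπ hS hD, fun r hr hord => ?_⟩
  rw [hord]
  refine NCDiff.dIrr_eq_avoidingWords lam hr fun s hs => ?_
  obtain ⟨t, ht, -⟩ := hS.1.monic s hs
  exact ⟨t, hord ▸ ht⟩
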